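/- **Setting.** Let $m,r\in\mathbb N$ with $1\le r\le 2m$, $a\in\mathbb R$, and $J=\begin{pmatrix}0&-I_m\\ I_m&0\end{pmatrix}$. Let $W(x)\in\mathbb C^{r\times r}$ and $B(x)\in\mathbb C^{2m\times 2m}$ have entries in $L^1_{\rm loc}([a,\infty))$, with $W(x)>0$ and $B(x)=B(x)^*$ for a.e. $x\in(a,\infty)$, and put $$A=\begin{pmatrix}W&0\\0&0\end{pmatrix},\quad C=\begin{pmatrix}W^{-1}&0\\0&I_{2m-r}\end{pmatrix},\quad E_r=\begin{pmatrix}I_r&0\\0&0\end{pmatrix}\in\mathbb C^{2m\times2m}.$$ Let $\widehat E_r:\mathbb C^{2m}\to\mathbb C^r$ be the restriction to the first $r$ coordinates and $\widehat E_r^*$ its adjoint (extension by zero). $L^2_W(s)^r$ has norm $\|f\|_W^2=\int_s f^*Wf\,dx$, and $L^2_A(s)^{2m}$ consists of the measurable $F:s\to\mathbb C^{2m}$ with $\|F\|_A:=\|\widehat E_rF\|_W<\infty$. Solutions of the system $J\Psi'=(zA+B)\Psi$ on $[a,\infty)$ are understood to be locally absolutely continuous on $[a,\infty)$ and to satisfy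 the equation a.e. Assume: * (definiteness) for every $z\in\mathbb C$, every nonzero $\mathbb C^{2m}$-valued solution $\Psi$, and all $a<c<d<\infty$, $\int_c^d\Psi^*A\Psi\,dx>0$; * (limit point case at $\infty$) for all $z\in\mathbb C\setminus\mathbb R$ and $c>a$, the space of $\mathbb C^{2m}$-valued solutions that lie in $L^2_A((c,\infty))^{2m}$ has dimension $m$; * $\alpha\in\mathbb C^{2m\times m}$ is such that $(\alpha\;\;J\alpha)$ is unitary. Let $\tau F=C(JF'-BF)$. The operator $T_a F=\tau F$ has as domain all $F\in AC_{\rm loc}([a,\infty))^{2m}\cap L^2_A((a,\infty))^{2m}$ with $\alpha^*JF(a)=0$ and $\tau F\in E_rL^2_A((a,\infty))^{2m}$. For $c\in(a,\infty)$ and $\gamma\in\mathbb C^{2m\times m}$, the operator $T_{a,c}F=\tau F$ has as domain all $F\in AC([a,c])^{2m}\cap L^2_A((a,c))^{2m}$ with $\alpha^*JF(a)=0=\gamma^*JF(c)$ and $\tau F\in E_rL^2_A((a,c))^{2m}$. For each of these operators $T$, $\sigma(T)$ is the set of $z\in\mathbb C$ for which $T-zE_r$, as a map from $\operatorname{dom}(T)$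 to $E_rL^2_A$, fails to be a bijection with bounded inverse. For $z\notin\sigma(T_{a,c})$ let $R_{a,c}(z)=\widehat E_r(T_{a,c}-zE_r)^{-1}\widehat E_r^*$ on $L^2_W((a,c))^r$. Let $x_0\in(a,\infty)$ and $\lambda_0<\lambda_1$ be real with $\lambda_0\notin\sigma(T_a)$, and suppose that the following Weyl–Titchmarsh solutions with values in $\mathbb C^{2m\times m}$ exist: $\Psi_+(\lambda_0,\cdot,x_0)$, a solution for $z=\lambda_0$ whose columns lie in $L^2_A((c,\infty))^{2m}$ for every $c>a$, and $\Psi_{-,\alpha}(\lambda_1,\cdot,x_0)$, a solution for $z=\lambda_1$ with $\alpha^*J\Psi_{-,\alpha}(\lambda_1,a,x_0)=0$; both normalized so that their upper $m\times m$ block at $x_0$ is $I_m$. **Theorem.** Let $c\in(a,\infty)$. Then there is a Prüfer angle of $\Psi_+(\lambda_0,\cdot,x_0)$ at $c$, that is, a Hermitian $\theta\in\mathbb C^{m\times m}$ such that $\Psi_+(\lambda_0,c,x_0)=\binom{\sin\theta}{\cos\theta}\rho$ for some $\rho\in\mathbb C^{m\times m}$ with $\rho^*\rho>0$. For every such $\theta$,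 if $T_{a,c}$ is defined with $\gamma=\binom{\sin\theta}{\cos\theta}$, then $\lambda_0\notin\sigma(T_{a,c})$ and $$\dim\ker(T_{a,c}-\lambda_1E_r)=\dim\ker\bigl(R_{a,c}(\lambda_0)-(\lambda_1-\lambda_0)^{-1}I_{L^2_W((a,c))^r}\bigr)=\dim\ker\bigl(\Psi_+(\lambda_0,c,x_0)^*J\,\Psi_{-,\alpha}(\lambda_1,c,x_0)\bigr).$$ -/

import Mathlib

open MeasureTheory Set Matrix
open scoped ENNReal NNReal ComplexOrder

set_option maxSynthPendingDepth 3

noncomputable section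

/-- `ℂ^{2m}`, with coordinates split into the first `m` and the last `m`. -/
abbrev CVec (m : ℕ) : Type := Fin m ⊕ Fin m → ℂ

/-- The restriction matrix `Ê_r : ℂ^{2m} → ℂ^r` onto the first `r` coordinates. -/
def hatE (m r : ℕ) : Matrix (Fin r) (Fin m ⊕ Fin m) ℂ :=
  Matrix.of fun k i => if (finSumFinEquiv i : ℕ) = (k : ℕ) then 1 else 0

/-- `E_r = diag(I_r, 0)`; here `(hatE m r)ᴴ` is the extension by zero `ℂ^r → ℂ^{2m}`. -/
def Er (m r : ℕ) : Matrix (Fin m ⊕ Fin m) (Fin m ⊕ Fin m) ℂ :=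
  (hatE m r)ᴴ * hatE m r

/-- The coefficients `W`, `B` of a Hamiltonian system on the half-line `[a, ∞)`. -/
structure HamiltonianSystem (m r : ℕ) (a : ℝ) where
  W : ℝ → Matrix (Fin r) (Fin r) ℂ
  B : ℝ → Matrix (Fin m ⊕ Fin m) (Fin m ⊕ Fin m) ℂ
  one_le_r : 1 ≤ r
  r_le : r ≤ 2 * m
  W_posDef : ∀ᵐ x ∂volume.restrict (Ioi a), (W x).PosDef
  W_int : ∀ i j, LocallyIntegrableOn (fun x => W x i j) (Ici a) volume
  B_herm : ∀ᵐ x ∂volume.restrict (Ioi a), (B x).IsHermitian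
  B_int : ∀ i j, LocallyIntegrableOn (fun x => B x i j) (Ici a) volume

/-- The open interval `(a, c)`, where `c` is real or `∞`. -/
def ival (a : ℝ) (c : EReal) : Set ℝ := {x | a < x ∧ (x : EReal) < c}

lemma measurableSet_ival (a : ℝ) (c : EReal) : MeasurableSet (ival a c) :=
  measurableSet_Ioi.inter (measurable_coe_real_ereal measurableSet_Iio)

lemma ival_subset (a : ℝ) (c : EReal) : ival a c ⊆ Ioi a := fun _ hx => hx.1

/-- The dimension of the kernel of a linear map, as a cardinal. -/
def nullity {M N : Type} [AddCommGroup M] [Module ℂ M] [AddCommGroup N] [Module ℂ N]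
    (S : M →ₗ[ℂ] N) : Cardinal :=
  Module.rank ℂ (LinearMap.ker S)

lemma continuous_mulVec {p q : Type} [Fintype q] (M : Matrix p q ℂ) :
    Continuous fun v : q → ℂ => M *ᵥ v := by
  fun_prop

/-- Pointwise action of a constant matrix on a.e.-classes of vector-valued functions. -/
def aeMulVec {p q : Type} [Fintype p] [Fintype q] (μ : Measure ℝ) (M : Matrix p q ℂ) :
    (ℝ →ₘ[μ] (q → ℂ)) →ₗ[ℂ] (ℝ →ₘ[μ] (p → ℂ)) where
  toFun f := AEEqFun.comp (fun v => M *ᵥ v) (continuous_mulVec M) f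
  map_add' f g := by
    induction f using AEEqFun.induction_on with | _ f hf
    induction g using AEEqFun.induction_on with | _ g hg
    simp only [AEEqFun.mk_add_mk, AEEqFun.comp_mk]
    congr 1
    funext x
    simp [Matrix.mulVec_add]
  map_smul' t f := by
    induction f using AEEqFun.induction_on with | _ f hf
    simp only [AEEqFun.smul_mk, AEEqFun.comp_mk, RingHom.id_apply]
    congr 1
    funext x
    simp [Matrix.mulVec_smul]

lemma aeMulVec_coe {p q : Type} [Fintype p] [Fintype q] (μ : Measure ℝ) (M : Matrix p q ℂ)
    (f : ℝ →ₘ[μ] (q → ℂ)) : aeMulVec μ M f =ᵐ[μ] fun x => M *ᵥ f x :=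
  AEEqFun.coeFn_comp _ (continuous_mulVec M) f

lemma hatE_mul_conjTranspose {m r : ℕ} (h : r ≤ 2 * m) :
    hatE m r * (hatE m r)ᴴ = 1 := by
  ext k l
  have hk : (k : ℕ) < m + m := by have := k.2; omega
  simp only [hatE, Matrix.mul_apply, Matrix.conjTranspose_apply, Matrix.of_apply]
  rw [Finset.sum_eq_single (finSumFinEquiv.symm (⟨k, hk⟩ : Fin (m + m)))]
  · by_cases hkl : k = l
    · subst hkl; simp
    · have : ¬ ((k : ℕ) = (l : ℕ)) := fun h => hkl (Fin.ext h)
      simp [this, Matrix.one_apply_ne hkl]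
  · intro i _ hi
    have : ¬ ((finSumFinEquiv i : ℕ) = (k : ℕ)) := by
      intro h
      exact hi (by rw [Equiv.eq_symm_apply]; exact Fin.ext h)
    simp [this]
  · simp

lemma Er_mul_hatE {m r : ℕ} (h : r ≤ 2 * m) :
    Er m r * (hatE m r)ᴴ = (hatE m r)ᴴ := by
  rw [Er, Matrix.mul_assoc, hatE_mul_conjTranspose h, Matrix.mul_one]

namespace HamiltonianSystem

variable {m r : ℕ} {a : ℝ} (S : HamiltonianSystem m r a)

/-- `A = diag(W, 0)`. -/
def A (x : ℝ) : Matrix (Fin m ⊕ Fin m) (Fin m ⊕ Fin m) ℂ :=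
  (hatE m r)ᴴ * S.W x * hatE m r

/-- `C = diag(W⁻¹, I_{2m-r})`. -/
def C (x : ℝ) : Matrix (Fin m ⊕ Fin m) (Fin m ⊕ Fin m) ℂ :=
  (hatE m r)ᴴ * (S.W x)⁻¹ * hatE m r + (1 - Er m r)

/-- The differential expression `τ F = C (J F' - B F)`. -/
def tau (F : ℝ → CVec m) (x : ℝ) : CVec m :=
  S.C x *ᵥ (Matrix.J (Fin m) ℂ *ᵥ deriv F x - S.B x *ᵥ F x)

/-- `‖f‖²` in `L²_W(s)^r`, i.e. `∫_s f* W f dx`, with values in `[0, ∞]`. -/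
def normSqW (s : Set ℝ) (f : ℝ → Fin r → ℂ) : ℝ≥0∞ :=
  ∫⁻ x in s, ENNReal.ofReal (star (f x) ⬝ᵥ (S.W x *ᵥ f x)).re

/-- The squared seminorm of `L²_A(s)^{2m}`: `‖F‖_A = ‖Ê_r F‖_W`. -/
def normSqA (s : Set ℝ) (F : ℝ → CVec m) : ℝ≥0∞ :=
  S.normSqW s fun x => hatE m r *ᵥ F x

/-- `F ∈ L²_A(s)^{2m}`. -/
def MemL2A (s : Set ℝ) (F : ℝ → CVec m) : Prop :=
  AEStronglyMeasurable F (volume.restrict s) ∧ S.normSqA s F < ∞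

lemma normSqW_congr {s : Set ℝ} {f g : ℝ → Fin r → ℂ} (h : f =ᵐ[volume.restrict s] g) :
    S.normSqW s f = S.normSqW s g :=
  lintegral_congr_ae (h.mono fun x hx => by simp only [hx])

lemma normSqA_congr {s : Set ℝ} {f g : ℝ → CVec m} (h : f =ᵐ[volume.restrict s] g) :
    S.normSqA s f = S.normSqA s g :=
  S.normSqW_congr (h.mono fun x hx => by simp only [hx])

lemma normSqW_zero (s : Set ℝ) : S.normSqW s (fun _ => 0) = 0 := by simp [normSqW]

lemma normSqW_smul (s : Set ℝ) (t : ℂ) (f : ℝ → Fin r → ℂ) :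
    S.normSqW s (fun x => t • f x) = ENNReal.ofReal (‖t‖ ^ 2) * S.normSqW s f := by
  unfold normSqW
  rw [← lintegral_const_mul' _ _ ENNReal.ofReal_ne_top]
  refine lintegral_congr fun x => ?_
  rw [← ENNReal.ofReal_mul (by positivity)]
  congr 1
  rw [Matrix.mulVec_smul, star_smul, smul_dotProduct, dotProduct_smul, smul_eq_mul, smul_eq_mul,
    ← mul_assoc]
  have : star t * t = ((‖t‖ ^ 2 : ℝ) : ℂ) := by
    rw [Complex.star_def, ← Complex.normSq_eq_conj_mul_self, Complex.normSq_eq_norm_sq]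
  rw [this, Complex.re_ofReal_mul]

lemma aemeasurable_W {s : Set ℝ} (hs : s ⊆ Ioi a) (i j : Fin r) :
    AEStronglyMeasurable (fun x => S.W x i j) (volume.restrict s) :=
  (S.W_int i j).aestronglyMeasurable.mono_set (hs.trans Ioi_subset_Ici_self)

lemma normSqW_add_lt_top {s : Set ℝ} (hs : s ⊆ Ioi a) {f g : ℝ → Fin r → ℂ}
    (hfm : AEStronglyMeasurable f (volume.restrict s))
    (hf : S.normSqW s f < ∞) (hg : S.normSqW s g < ∞) :
    S.normSqW s (fun x => f x + g x) < ∞ := by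
  have hpos : ∀ᵐ x ∂volume.restrict s, (S.W x).PosDef :=
    ae_restrict_of_ae_restrict_of_subset hs S.W_posDef
  have hmeas : AEMeasurable
      (fun x => ENNReal.ofReal (star (f x) ⬝ᵥ (S.W x *ᵥ f x)).re) (volume.restrict s) := by
    have hcoord : ∀ i, AEMeasurable (fun x => f x i) (volume.restrict s) := fun i =>
      (measurable_pi_apply i).comp_aemeasurable hfm.aemeasurable
    have hW : ∀ i j, AEMeasurable (fun x => S.W x i j) (volume.restrict s) := fun i j =>
      (S.aemeasurable_W hs i j).aemeasurable
    refine ENNReal.measurable_ofReal.comp_aemeasurable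
      (Complex.measurable_re.comp_aemeasurable ?_)
    simp only [dotProduct, Matrix.mulVec, Pi.star_apply]
    refine Finset.aemeasurable_fun_sum _ fun i _ => ?_
    refine AEMeasurable.mul ?_ (Finset.aemeasurable_fun_sum _ fun j _ => (hW i j).mul (hcoord j))
    exact (continuous_star.measurable).comp_aemeasurable (hcoord i)
  have key : S.normSqW s (fun x => f x + g x) ≤ 2 * S.normSqW s f + 2 * S.normSqW s g := by
    unfold normSqW
    rw [← lintegral_const_mul' _ _ (by simp), ← lintegral_const_mul' _ _ (by simp),
      ← lintegral_add_left' (hmeas.const_mul _)]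
    refine lintegral_mono_ae (hpos.mono fun x hx => ?_)
    have h2 : (2 : ℝ≥0∞) = ENNReal.ofReal 2 := by simp
    have p1 : 0 ≤ (star (f x) ⬝ᵥ (S.W x *ᵥ f x)).re := hx.posSemidef.re_dotProduct_nonneg _
    have p2 : 0 ≤ (star (g x) ⬝ᵥ (S.W x *ᵥ g x)).re := hx.posSemidef.re_dotProduct_nonneg _
    have p3 : 0 ≤ (star (f x - g x) ⬝ᵥ (S.W x *ᵥ (f x - g x))).re :=
      hx.posSemidef.re_dotProduct_nonneg _
    rw [h2, ← ENNReal.ofReal_mul (by norm_num), ← ENNReal.ofReal_mul (by norm_num),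
      ← ENNReal.ofReal_add (by positivity) (by positivity)]
    refine ENNReal.ofReal_le_ofReal ?_
    simp only [star_sub, star_add, Matrix.mulVec_sub, Matrix.mulVec_add, sub_dotProduct,
      add_dotProduct, dotProduct_sub, dotProduct_add, Complex.sub_re, Complex.add_re] at p3 ⊢
    linarith
  exact key.trans_lt (ENNReal.add_lt_top.2
    ⟨ENNReal.mul_lt_top (by simp) hf, ENNReal.mul_lt_top (by simp) hg⟩)

/-- The space `L²_W((a,c))^r` of a.e.-classes. -/
def L2W (c : EReal) : Submodule ℂ (ℝ →ₘ[volume.restrict (ival a c)] (Fin r → ℂ)) where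
  carrier := {f | S.normSqW (ival a c) f < ∞}
  zero_mem' := by
    have h : S.normSqW (ival a c) (0 : ℝ →ₘ[volume.restrict (ival a c)] (Fin r → ℂ)) = 0 := by
      rw [S.normSqW_congr AEEqFun.coeFn_zero]; exact S.normSqW_zero _
    simp only [Set.mem_ofPred_eq, h]; simp
  add_mem' {f g} hf hg := by
    simp only [Set.mem_ofPred_eq] at hf hg ⊢
    rw [S.normSqW_congr (AEEqFun.coeFn_add f g)]
    exact S.normSqW_add_lt_top (ival_subset a c) f.aestronglyMeasurable hf hg
  smul_mem' t f hf := by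
    simp only [Set.mem_ofPred_eq] at hf ⊢
    rw [S.normSqW_congr (AEEqFun.coeFn_smul t f)]
    refine (S.normSqW_smul _ t f).trans_lt (ENNReal.mul_lt_top ENNReal.ofReal_lt_top hf)

/-- The space `E_r L²_A((a,c))^{2m}` of a.e.-classes: those `G` with finite seminorm and
`E_r G = G`. -/
def ErL2A (c : EReal) : Submodule ℂ (ℝ →ₘ[volume.restrict (ival a c)] CVec m) :=
  (S.L2W c).comap (aeMulVec _ (hatE m r)) ⊓ LinearMap.ker (aeMulVec _ (Er m r) - LinearMap.id)

/-- `Ê_r* : L²_W((a,c))^r → E_r L²_A((a,c))^{2m}`, extension by zero of vectors. -/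
def extE (c : EReal) : S.L2W c →ₗ[ℂ] S.ErL2A c :=
  ((aeMulVec _ (hatE m r)ᴴ).comp (S.L2W c).subtype).codRestrict (S.ErL2A c) fun f => by
    have comp_eq : ∀ {p q s : Type} [Fintype p] [Fintype q] [Fintype s]
        (M : Matrix p q ℂ) (N : Matrix q s ℂ)
        (f : ℝ →ₘ[volume.restrict (ival a c)] (s → ℂ)),
        aeMulVec _ M (aeMulVec _ N f) = aeMulVec _ (M * N) f := by
      intro p q s _ _ _ M N f
      refine AEEqFun.ext ?_
      filter_upwards [aeMulVec_coe _ M (aeMulVec _ N f), aeMulVec_coe _ N f,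
        aeMulVec_coe _ (M * N) f] with x h1 h2 h3
      rw [h1, h2, h3, Matrix.mulVec_mulVec]
    refine ⟨?_, ?_⟩
    · change aeMulVec _ (hatE m r) (aeMulVec _ (hatE m r)ᴴ f.1) ∈ S.L2W c
      rw [comp_eq, hatE_mul_conjTranspose S.r_le]
      have : aeMulVec _ (1 : Matrix (Fin r) (Fin r) ℂ) f.1 = f.1 := by
        refine AEEqFun.ext ?_
        filter_upwards [aeMulVec_coe _ (1 : Matrix (Fin r) (Fin r) ℂ) f.1] with x h1
        rw [h1, Matrix.one_mulVec]
      rw [this]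
      exact f.2
    · change aeMulVec _ (Er m r) (aeMulVec _ (hatE m r)ᴴ f.1) - aeMulVec _ (hatE m r)ᴴ f.1 = 0
      rw [comp_eq, Er_mul_hatE S.r_le, sub_self]

/-- The solutions on `[a, ∞)` of `J F' = (z A + B) F` (a.e.), with `F` locally absolutely
continuous on `[a, ∞)`. -/
def IsSolution (z : ℂ) (F : ℝ → CVec m) : Prop :=
  (∀ d, a ≤ d → AbsolutelyContinuousOnInterval F a d) ∧
  ∀ᵐ x ∂volume.restrict (Ioi a),
    Matrix.J (Fin m) ℂ *ᵥ deriv F x = (z • S.A x + S.B x) *ᵥ F x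

/-- Matrix-valued solutions: every column is a solution. -/
def IsMatSolution (z : ℂ) (Ψ : ℝ → Matrix (Fin m ⊕ Fin m) (Fin m) ℂ) : Prop :=
  ∀ j, S.IsSolution z fun x i => Ψ x i j

/-- Atkinson's definiteness condition. -/
def Definite : Prop :=
  ∀ (z : ℂ) (F : ℝ → CVec m), S.IsSolution z F → (∃ x, a ≤ x ∧ F x ≠ 0) →
    ∀ c d, a < c → c < d → 0 < S.normSqA (Icc c d) F

lemma ae_differentiableAt {F : ℝ → CVec m} {c : EReal}
    (hF : ∀ d : ℝ, a ≤ d → (d : EReal) ≤ c → AbsolutelyContinuousOnInterval F a d) :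
    ∀ᵐ x ∂volume.restrict (ival a c), DifferentiableAt ℝ F x := by
  rw [ae_restrict_iff' (measurableSet_ival a c)]
  have h : ∀ q : ℚ, ∀ᵐ x : ℝ, a ≤ (q : ℝ) → ((q : ℝ) : EReal) ≤ c → x ∈ uIcc a (q : ℝ) →
      DifferentiableAt ℝ F x := by
    intro q
    by_cases h1 : a ≤ (q : ℝ)
    · by_cases h2 : ((q : ℝ) : EReal) ≤ c
      · filter_upwards [(hF q h1 h2).boundedVariationOn.ae_differentiableAt_of_mem_uIcc]
          with x hx _ _ using hx
      · exact Filter.Eventually.of_forall fun x _ h => absurd h h2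
    · exact Filter.Eventually.of_forall fun x h => absurd h h1
  filter_upwards [ae_all_iff.2 h] with x hx hxI
  obtain ⟨q, hq1, hq2⟩ := EReal.exists_rat_btwn_of_lt hxI.2
  have hq1' : x < (q : ℝ) := by exact_mod_cast hq1
  have ha : a ≤ (q : ℝ) := hxI.1.le.trans hq1'.le
  exact hx q ha hq2.le (by rw [uIcc_of_le ha]; exact ⟨hxI.1.le, hq1'.le⟩)

lemma tau_add {F G : ℝ → CVec m} {x : ℝ} (hF : DifferentiableAt ℝ F x)
    (hG : DifferentiableAt ℝ G x) : S.tau (F + G) x = S.tau F x + S.tau G x := by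
  simp only [tau, deriv_add hF hG, Pi.add_apply]
  rw [← Matrix.mulVec_add, Matrix.mulVec_add, Matrix.mulVec_add]
  congr 1
  abel

lemma tau_smul (t : ℂ) (F : ℝ → CVec m) (x : ℝ) : S.tau (t • F) x = t • S.tau F x := by
  simp only [tau, deriv_const_smul_field, Pi.smul_apply, Matrix.mulVec_smul, ← smul_sub]

lemma memL2A_zero (s : Set ℝ) : S.MemL2A s 0 := by
  refine ⟨aestronglyMeasurable_zero, ?_⟩
  simp [normSqA, normSqW]

lemma MemL2A.add {S : HamiltonianSystem m r a} {s : Set ℝ} (hs : s ⊆ Ioi a) {F G : ℝ → CVec m}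
    (hF : S.MemL2A s F) (hG : S.MemL2A s G) : S.MemL2A s (F + G) := by
  refine ⟨hF.1.add hG.1, ?_⟩
  have h := S.normSqW_add_lt_top hs
    ((continuous_const.matrix_mulVec continuous_id).comp_aestronglyMeasurable hF.1) hF.2 hG.2
  simpa [normSqA, Matrix.mulVec_add] using h

lemma MemL2A.smul {S : HamiltonianSystem m r a} {s : Set ℝ} (t : ℂ) {F : ℝ → CVec m}
    (hF : S.MemL2A s F) : S.MemL2A s (t • F) := by
  refine ⟨hF.1.const_smul t, ?_⟩
  have h := (S.normSqW_smul s t fun x => hatE m r *ᵥ F x)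
  have h2 : S.normSqA s (t • F) = ENNReal.ofReal (‖t‖ ^ 2) * S.normSqA s F := by
    rw [normSqA, normSqA, ← h]
    simp only [Pi.smul_apply, Matrix.mulVec_smul]
  rw [h2]
  exact ENNReal.mul_lt_top ENNReal.ofReal_lt_top hF.2

/-- The space of solutions of the system that lie in `L²_A((c,∞))^{2m}`. Functions on `[a,∞)` are
represented by their extensions by zero to `ℝ`. -/
def L2Sol (z : ℂ) (c : ℝ) (hc : a < c) : Submodule ℂ (ℝ → CVec m) where
  carrier := {F | (∀ x, x < a → F x = 0) ∧ S.IsSolution z F ∧ S.MemL2A (Ioi c) F}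
  zero_mem' := by
    refine ⟨fun _ _ => rfl, ⟨fun d _ => ?_, ?_⟩, S.memL2A_zero _⟩
    · exact (LipschitzWith.const (0 : CVec m)).lipschitzOnWith.absolutelyContinuousOnInterval
    · refine Filter.Eventually.of_forall fun x => ?_
      have : deriv (0 : ℝ → CVec m) x = 0 := by simp
      rw [this]; simp
  add_mem' {F G} hF hG := by
    refine ⟨fun x hx => by simp [hF.1 x hx, hG.1 x hx],
      ⟨fun d hd => (hF.2.1.1 d hd).add (hG.2.1.1 d hd), ?_⟩,
      hF.2.2.add (Ioi_subset_Ioi hc.le) hG.2.2⟩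
    have e : ival a ⊤ = Ioi a := by ext x; simp [ival]
    have h1 := ae_differentiableAt (c := ⊤) fun d hd _ => hF.2.1.1 d hd
    have h2 := ae_differentiableAt (c := ⊤) fun d hd _ => hG.2.1.1 d hd
    rw [e] at h1 h2
    filter_upwards [h1, h2, hF.2.1.2, hG.2.1.2] with x d1 d2 e1 e2
    rw [deriv_add d1 d2, Pi.add_apply, Matrix.mulVec_add, Matrix.mulVec_add, e1, e2]
  smul_mem' t F hF := by
    refine ⟨fun x hx => by simp [hF.1 x hx],
      ⟨fun d hd => (hF.2.1.1 d hd).const_smul t, ?_⟩, hF.2.2.smul t⟩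
    filter_upwards [hF.2.1.2] with x e1
    rw [deriv_const_smul_field, Pi.smul_apply, Matrix.mulVec_smul, Matrix.mulVec_smul, e1]

/-- The limit point case at `∞`. -/
def LimitPoint : Prop :=
  ∀ z : ℂ, z.im ≠ 0 → ∀ (c : ℝ) (hc : a < c), Module.finrank ℂ (S.L2Sol z c hc) = m

/-- The maximal domain on `(a, c)`, `c ∈ (a, ∞]`: functions `F` that are (locally) absolutely
continuous on `[a, c]` (on `[a, ∞)` if `c = ∞`) with `F ∈ L²_A` and `τ F ∈ E_r L²_A`.
Functions on `[a, c]`, resp. `[a, ∞)`, are represented by their extensions by zero to `ℝ`. -/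
def maxDom (c : EReal) : Submodule ℂ (ℝ → CVec m) where
  carrier := {F | (∀ x : ℝ, ¬ (a ≤ x ∧ (x : EReal) ≤ c) → F x = 0) ∧
    (∀ d : ℝ, a ≤ d → (d : EReal) ≤ c → AbsolutelyContinuousOnInterval F a d) ∧
    S.MemL2A (ival a c) F ∧
    ∃ G : S.ErL2A c, S.tau F =ᵐ[volume.restrict (ival a c)] G.1}
  zero_mem' := by
    refine ⟨fun _ _ => rfl, fun d _ _ => ?_, S.memL2A_zero _, 0, ?_⟩
    · exact (LipschitzWith.const (0 : CVec m)).lipschitzOnWith.absolutelyContinuousOnInterval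
    · filter_upwards [AEEqFun.coeFn_zero (μ := volume.restrict (ival a c)) (β := CVec m)]
        with x hx
      change _ = (0 : ℝ →ₘ[volume.restrict (ival a c)] CVec m) x
      rw [hx]
      have : deriv (0 : ℝ → CVec m) x = 0 := by simp
      simp [tau, this]
  add_mem' {F G} hF hG := by
    obtain ⟨F0, Fac, FL, f, hf⟩ := hF
    obtain ⟨G0, Gac, GLp, g, hg⟩ := hG
    refine ⟨fun x hx => by simp [F0 x hx, G0 x hx], fun d h1 h2 => (Fac d h1 h2).add (Gac d h1 h2),
      FL.add (ival_subset a c) GLp, f + g, ?_⟩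
    filter_upwards [ae_differentiableAt Fac, ae_differentiableAt Gac, hf, hg,
      AEEqFun.coeFn_add f.1 g.1] with x d1 d2 e1 e2 e3
    rw [S.tau_add d1 d2, e1, e2]
    exact e3.symm
  smul_mem' t F hF := by
    obtain ⟨F0, Fac, FL, f, hf⟩ := hF
    refine ⟨fun x hx => by simp [F0 x hx], fun d h1 h2 => (Fac d h1 h2).const_smul t,
      FL.smul t, t • f, ?_⟩
    filter_upwards [hf, AEEqFun.coeFn_smul t f.1] with x e1 e3
    rw [S.tau_smul, e1]
    exact e3.symm

lemma ErL2A_ext {c : EReal} {G H : S.ErL2A c} (h : G.1 =ᵐ[volume.restrict (ival a c)] H.1) :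
    G = H := Subtype.ext (AEEqFun.ext h)

/-- The operator `F ↦ τ F` from the maximal domain into `E_r L²_A((a,c))^{2m}`. -/
def maxOp (c : EReal) : S.maxDom c →ₗ[ℂ] S.ErL2A c where
  toFun F := F.2.2.2.2.choose
  map_add' F G := by
    refine S.ErL2A_ext ?_
    have e := AEEqFun.coeFn_add F.2.2.2.2.choose.1 G.2.2.2.2.choose.1
    filter_upwards [ae_differentiableAt F.2.2.1, ae_differentiableAt G.2.2.1,
      (F + G).2.2.2.2.choose_spec, F.2.2.2.2.choose_spec, G.2.2.2.2.choose_spec, e]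
      with x d1 d2 e1 e2 e3 e4
    rw [← e1]
    refine (S.tau_add d1 d2).trans ?_
    rw [e2, e3]
    exact e4.symm
  map_smul' t F := by
    refine S.ErL2A_ext ?_
    have e := AEEqFun.coeFn_smul t F.2.2.2.2.choose.1
    filter_upwards [(t • F).2.2.2.2.choose_spec, F.2.2.2.2.choose_spec, e] with x e1 e2 e4
    rw [← e1]
    refine (S.tau_smul t F x).trans ?_
    rw [e2]
    exact e4.symm

lemma maxOp_coe {c : EReal} (F : S.maxDom c) :
    (S.maxOp c F).1 =ᵐ[volume.restrict (ival a c)] S.tau F :=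
  F.2.2.2.2.choose_spec.symm

/-- The a.e.-class on `(a, c)` of an element of the maximal domain. -/
def toClass (c : EReal) : S.maxDom c →ₗ[ℂ] (ℝ →ₘ[volume.restrict (ival a c)] CVec m) where
  toFun F := AEEqFun.mk F F.2.2.2.1.1
  map_add' _ _ := rfl
  map_smul' _ _ := rfl

/-- `F ↦ Ê_r F ∈ L²_W((a,c))^r`. -/
def hatOp (c : EReal) : S.maxDom c →ₗ[ℂ] S.L2W c :=
  ((aeMulVec _ (hatE m r)).comp (S.toClass c)).codRestrict (S.L2W c) fun F => by
    change S.normSqW _ _ < ∞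
    have h := F.2.2.2.1.2
    rw [normSqA] at h
    rwa [S.normSqW_congr (g := fun x => hatE m r *ᵥ (F : ℝ → CVec m) x)]
    filter_upwards [aeMulVec_coe _ (hatE m r) (S.toClass c F),
      AEEqFun.coeFn_mk (F : ℝ → CVec m) F.2.2.2.1.1] with x h1 h2
    exact h1.trans (congrArg _ h2)

/-- `F ↦ E_r F = Ê_r* Ê_r F ∈ E_r L²_A((a,c))^{2m}`. -/
def ErOp (c : EReal) : S.maxDom c →ₗ[ℂ] S.ErL2A c := (S.extE c).comp (S.hatOp c)

/-- The boundary condition `β* J F(x) = 0` on the maximal domain. -/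
def bc (c : EReal) (β : Matrix (Fin m ⊕ Fin m) (Fin m) ℂ) (x : ℝ) :
    Submodule ℂ (S.maxDom c) where
  carrier := {F | βᴴ *ᵥ (Matrix.J (Fin m) ℂ *ᵥ (F : ℝ → CVec m) x) = 0}
  zero_mem' := by simp
  add_mem' {F G} hF hG := by
    simp only [Set.mem_ofPred_eq] at hF hG ⊢
    simp [Matrix.mulVec_add, hF, hG]
  smul_mem' t F hF := by
    simp only [Set.mem_ofPred_eq] at hF ⊢
    simp only [Submodule.coe_smul, Pi.smul_apply, Matrix.mulVec_smul, hF, smul_zero]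

/-- `dom(T_a)`: the boundary condition given by `α` at `a`. -/
def domHalf (α : Matrix (Fin m ⊕ Fin m) (Fin m) ℂ) : Submodule ℂ (S.maxDom ⊤) :=
  S.bc ⊤ α a

/-- `dom(T_{a,c})`: the boundary conditions given by `α` at `a` and by `γ` at `c`. -/
def domFin (α γ : Matrix (Fin m ⊕ Fin m) (Fin m) ℂ) (c : ℝ) : Submodule ℂ (S.maxDom c) :=
  S.bc c α a ⊓ S.bc c γ c

/-- `T - z E_r` for the operator `T : F ↦ τ F` with domain `D`. -/
def pencil {c : EReal} (D : Submodule ℂ (S.maxDom c)) (z : ℂ) : D →ₗ[ℂ] S.ErL2A c :=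
  (S.maxOp c - z • S.ErOp c).domRestrict D

/-- The spectrum of the operator `T : F ↦ τ F` with domain `D`: those `z` for which `T - z E_r` is
not a bijection of `D` onto `E_r L²_A((a,c))^{2m}` with bounded inverse. -/
def spectrum {c : EReal} (D : Submodule ℂ (S.maxDom c)) : Set ℂ :=
  {z | ¬ (Function.Bijective (S.pencil D z) ∧
    ∃ K : ℝ≥0, ∀ F : D, S.normSqA (ival a c) (F : S.maxDom c) ≤
      (K : ℝ≥0∞) * S.normSqA (ival a c) (S.pencil D z F).1)}

lemma bijective_of_notMem_spectrum {c : EReal} {D : Submodule ℂ (S.maxDom c)} {z : ℂ}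
    (h : z ∉ S.spectrum D) : Function.Bijective (S.pencil D z) :=
  (not_not.1 h).1

/-- The restricted resolvent `R(z) = Ê_r (T - z E_r)⁻¹ Ê_r*` on `L²_W((a,c))^r`. -/
def restrictedResolvent {c : EReal} {D : Submodule ℂ (S.maxDom c)} {z : ℂ}
    (h : z ∉ S.spectrum D) : S.L2W c →ₗ[ℂ] S.L2W c :=
  (S.hatOp c).comp (D.subtype.comp
    ((LinearEquiv.ofBijective (S.pencil D z) (S.bijective_of_notMem_spectrum h)).symm.toLinearMap.comp
      (S.extE c)))

/-- The normalization `Ψ(x₀) = (I_m M)ᵀ` for some `M`, i.e. `Ψ = U(·, x₀) (I_m M)ᵀ` with `U(·, x₀)`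
the fundamental matrix that equals `I_{2m}` at `x₀`. -/
def IsNormalizedAt (x₀ : ℝ) (Ψ : ℝ → Matrix (Fin m ⊕ Fin m) (Fin m) ℂ) : Prop :=
  ∃ M : Matrix (Fin m) (Fin m) ℂ, Ψ x₀ = Matrix.fromRows 1 M

/-- `Ψ` is the Weyl-Titchmarsh solution `Ψ_{-,α}(z, ·, x₀)`. -/
def IsWeylMinus (α : Matrix (Fin m ⊕ Fin m) (Fin m) ℂ) (z : ℂ) (x₀ : ℝ)
    (Ψ : ℝ → Matrix (Fin m ⊕ Fin m) (Fin m) ℂ) : Prop :=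
  S.IsMatSolution z Ψ ∧ αᴴ * Matrix.J (Fin m) ℂ * Ψ a = 0 ∧ IsNormalizedAt x₀ Ψ

/-- `Ψ` is the Weyl-Titchmarsh solution `Ψ_+(z, ·, x₀)` (used for `z` outside the spectrum of the
half-line operator). -/
def IsWeylPlus (z : ℂ) (x₀ : ℝ) (Ψ : ℝ → Matrix (Fin m ⊕ Fin m) (Fin m) ℂ) : Prop :=
  S.IsMatSolution z Ψ ∧ (∀ c, a < c → ∀ j, S.MemL2A (Ioi c) fun x i => Ψ x i j) ∧
    IsNormalizedAt x₀ Ψ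

end HamiltonianSystem

/-- `α ∈ ℂ^{2m × m}` is a boundary condition matrix: `(α  Jα)` is unitary. -/
def IsBoundaryMatrix {m : ℕ} (α : Matrix (Fin m ⊕ Fin m) (Fin m) ℂ) : Prop :=
  Matrix.fromCols α (Matrix.J (Fin m) ℂ * α) ∈ Matrix.unitaryGroup (Fin m ⊕ Fin m) ℂ

/-- The matrix `(sin θ  cos θ)ᵀ ∈ ℂ^{2m × m}` of a Hermitian matrix `θ`. -/
def sinCos {m : ℕ} (θ : Matrix (Fin m) (Fin m) ℂ) : Matrix (Fin m ⊕ Fin m) (Fin m) ℂ :=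
  Matrix.fromRows (cfc Real.sin θ) (cfc Real.cos θ)

/-- `θ` is a Prüfer angle of the value `P ∈ ℂ^{2m × m}` of a solution: `θ = θ*` and
`P = (sin θ  cos θ)ᵀ ρ` with `ρ* ρ > 0`. -/
def IsPrueferAngle {m : ℕ} (P : Matrix (Fin m ⊕ Fin m) (Fin m) ℂ)
    (θ : Matrix (Fin m) (Fin m) ℂ) : Prop :=
  θ.IsHermitian ∧ ∃ ρ : Matrix (Fin m) (Fin m) ℂ, (ρᴴ * ρ).PosDef ∧ P = sinCos θ * ρ

end

/-! Write Ψ for Ψ_+(λ₀), Ψ_- for Ψ_{-,α}(λ₁), U for the fundamental matrix at λ₀ and u*Jv for the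
skew-Hermitian form governed by Lagrange's identity (`jform_eq_add_integral`); it is constant along
two solutions with the same real spectral parameter. The central fact is that Ψ(c), which has rank
m, is isotropic: Ψ*JΨ = 0 (`IsWeylPlus.jform_eq_zero`). So its columns span a Lagrangian subspace.

This gives a Prüfer angle (`exists_isPrueferAngle`) and turns the condition γ*JF(c) = 0 into F(c) ∈
ran Ψ(c) (`exists_eq_mulVec_of_lagrangian`, `IsPrueferAngle.mulVec_eq_zero_iff`). With this
condition T_{a,c} inherits λ₀ ∉ σ from T_a (`IsWeylPlus.notMem_spectrum_domFin`): extend the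
right-hand side by zero beyond c, solve on the half-line, and note that the solution has the form Ψv
beyond c; conversely a kernel element on (a,c) continues as Ψv to a kernel element on the half-line.
The dimension formulas are then linear algebra. One has T - λ₁E_r = (T - λ₀E_r) - (λ₁ - λ₀)Ê_r*Ê_r,
and Ê_r identifies its kernel with that of the shifted restricted resolvent (`nullity_sub_eq`). The
solutions at λ₁ satisfying the condition at a are Ψ_-v, and the condition at c reads Ψ(c)*JΨ_-(c)v =
0 (`IsWeylMinus.nullity_pencil_eq`).

Isotropy comes from a duality argument. Let φ_w = Uαw. The constant matrix K = φ*JΨ = α*JΨ(a) is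
invertible because λ₀ is not an eigenvalue. Let R = Ψ*JΨ, fix v₀ and choose w with w*Kv = v₀*Rv for
all v. Definiteness gives a half-line solution F, with compactly supported right-hand side, equal to
Ψv₀ near ∞. For each d let H be the half-line solution with right-hand side φ_w cut off at d, and
let H = Ψu beyond d. Lagrange's identity gives N = ‖φ_w‖²_{(a,d)} = w*Ku = v₀*Ru = F(d)*JH(d).
Expanding this boundary form by Lagrange's identity again and using the resolvent bound, which is
uniform in d, yields N ≤ const + 3N/8. Hence φ_w is square integrable, so w = 0 because λ₀ ∉ σ(T_a).
As v₀ was arbitrary, R = 0. -/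

section AbsolutelyContinuous

/-! ### Absolutely continuous functions and the fundamental theorem of calculus -/

open Filter Topology AbsolutelyContinuousOnInterval

variable {X Y : Type*} [PseudoMetricSpace X] [PseudoMetricSpace Y]

/-- Absolute continuity only concerns sums of increments, so it passes to any function whose
increments are dominated. This comparison yields the integral, exponential, coordinate and
conjugation cases below. -/
lemma AbsolutelyContinuousOnInterval.of_dist_le {f : ℝ → X} {g : ℝ → Y} {a b C : ℝ}
    (hg : AbsolutelyContinuousOnInterval g a b)
    (h : ∀ x ∈ uIcc a b, ∀ y ∈ uIcc a b, dist (f x) (f y) ≤ C * dist (g x) (g y)) :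
    AbsolutelyContinuousOnInterval f a b := by
  unfold AbsolutelyContinuousOnInterval at hg ⊢
  refine squeeze_zero' (.of_forall fun _ => Finset.sum_nonneg fun _ _ => dist_nonneg) ?_
    (by simpa using hg.const_mul C)
  rw [eventually_inf_principal]
  refine .of_forall fun E hE => ?_
  rw [Finset.mul_sum]
  exact Finset.sum_le_sum fun i hi => h _ (hE.1 i hi).1 _ (hE.1 i hi).2

lemma AbsolutelyContinuousOnInterval.congr {f g : ℝ → X} {a b : ℝ}
    (hf : AbsolutelyContinuousOnInterval f a b) (h : EqOn f g (uIcc a b)) :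
    AbsolutelyContinuousOnInterval g a b :=
  hf.of_dist_le (C := 1) fun x hx y hy => by rw [h hx, h hy, one_mul]

variable {E : Type*} [NormedAddCommGroup E] [NormedSpace ℝ E]

lemma absolutelyContinuousOnInterval_integral {f : ℝ → E} {a b : ℝ}
    (hf : IntervalIntegrable f volume a b) :
    AbsolutelyContinuousOnInterval (fun x => ∫ t in a..x, f t) a b := by
  have hn := hf.norm.absolutelyContinuousOnInterval_intervalIntegral (c := a) left_mem_uIcc
  refine hn.of_dist_le (C := 1) fun x hx y hy => ?_
  have ix : ∀ z ∈ uIcc a b, IntervalIntegrable f volume a z := fun z hz =>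
    hf.mono_set (uIcc_subset_uIcc_left hz)
  rw [one_mul, dist_eq_norm, Real.dist_eq,
    intervalIntegral.integral_interval_sub_left (ix x hx) (ix y hy),
    intervalIntegral.integral_interval_sub_left (ix x hx).norm (ix y hy).norm]
  exact intervalIntegral.norm_integral_le_abs_integral_norm

/-- The difference of f and the primitive of g is absolutely continuous with derivative zero a.e.,
hence constant. The hypothesis on the open interval suffices since the endpoints are null. -/
lemma AbsolutelyContinuousOnInterval.eq_add_integral [CompleteSpace E] {f g : ℝ → E} {a b : ℝ}
    (hab : a ≤ b)
    (hf : AbsolutelyContinuousOnInterval f a b) (hg : IntervalIntegrable g volume a b)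
    (h : ∀ᵐ x ∂volume.restrict (Ioo a b), HasDerivAt f (g x) x) :
    f b = f a + ∫ x in a..b, g x := by
  have hac := hf.fun_sub (absolutelyContinuousOnInterval_integral hg)
  rw [ae_restrict_iff' measurableSet_Ioo] at h
  have ha : ∀ᵐ x : ℝ, x ≠ a := by simp [ae_iff]
  have hb : ∀ᵐ x : ℝ, x ≠ b := by simp [ae_iff]
  obtain ⟨C, hC⟩ := hac.const_of_ae_hasDerivAt_zero (by
    filter_upwards [h, hg.ae_hasDerivAt_integral, ha, hb] with x h1 h2 h3 h4 h5
    have h5' := h5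
    rw [uIcc_of_le hab] at h5'
    have := (h1 ⟨lt_of_le_of_ne h5'.1 (Ne.symm h3), lt_of_le_of_ne h5'.2 h4⟩).fun_sub
      (h2 h5 a left_mem_uIcc)
    rwa [sub_self] at this)
  have h1 := hC a left_mem_uIcc
  have h2 := hC b right_mem_uIcc
  simp only [intervalIntegral.integral_same, sub_zero] at h1
  rw [h1, ← h2, sub_add_cancel]

/-- The function k is bounded on the interval, and exp is Lipschitz on bounded sets. -/
lemma AbsolutelyContinuousOnInterval.exp {k : ℝ → ℝ} {a b : ℝ}
    (hk : AbsolutelyContinuousOnInterval k a b) :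
    AbsolutelyContinuousOnInterval (fun x => Real.exp (k x)) a b := by
  obtain ⟨D, hD⟩ := hk.exists_bound
  obtain ⟨C, hC⟩ := (Real.contDiff_exp (n := 1)).contDiffOn.exists_lipschitzOnWith (s := Icc (-D) D)
    (by decide) (convex_Icc _ _) isCompact_Icc
  refine hk.of_dist_le (C := C) fun x hx y hy => hC.dist_le_mul _ ?_ _ ?_
  · exact abs_le.1 (hD x hx)
  · exact abs_le.1 (hD y hy)

end AbsolutelyContinuous

/-! ### Global solvability of linear Volterra equations -/

section Volterra

open BoundedContinuousFunction

variable {E : Type*} [NormedAddCommGroup E] [NormedSpace ℝ E] [CompleteSpace E]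

/-- The integrand is half the derivative of exp(2k), where k is the primitive of ‖N‖. This is the
computation behind the contraction constant 1/2 in the weighted norm. -/
lemma integral_norm_mul_exp {E : Type*} [NormedAddCommGroup E] {N : ℝ → E}
    (hN : ∀ p q, IntervalIntegrable N volume p q) {a x : ℝ} (hx : a ≤ x) :
    IntervalIntegrable (fun s => ‖N s‖ * Real.exp (2 * ∫ t in a..s, ‖N t‖)) volume a x ∧
    ∫ s in a..x, ‖N s‖ * Real.exp (2 * ∫ t in a..s, ‖N t‖) =
      (Real.exp (2 * ∫ t in a..x, ‖N t‖) - 1) / 2 := by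
  have hn : ∀ p q, IntervalIntegrable (fun s => ‖N s‖) volume p q := fun p q => (hN p q).norm
  have hc : Continuous fun s => Real.exp (2 * ∫ t in a..s, ‖N t‖) :=
    Real.continuous_exp.comp (continuous_const.mul
      (intervalIntegral.continuous_primitive hn a))
  have hi := (hn a x).mul_continuousOn hc.continuousOn
  refine ⟨hi, ?_⟩
  have hac := ((absolutelyContinuousOnInterval_integral (hn a x)).const_mul 2).exp
  have := hac.eq_add_integral hx (g := fun s =>
      2 * (‖N s‖ * Real.exp (2 * ∫ t in a..s, ‖N t‖))) (hi.const_mul 2) (by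
    rw [ae_restrict_iff' measurableSet_Ioo]
    filter_upwards [(hn a x).ae_hasDerivAt_integral] with s hs h
    have hs' : s ∈ uIcc a x := by rw [uIcc_of_le hx]; exact Ioo_subset_Icc_self h
    rw [show 2 * (‖N s‖ * Real.exp (2 * ∫ t in a..s, ‖N t‖)) =
      Real.exp (2 * ∫ t in a..s, ‖N t‖) * (2 * ‖N s‖) by ring]
    exact ((hs hs' a left_mem_uIcc).const_mul 2).exp)
  rw [intervalIntegral.integral_const_mul] at this
  simp only [intervalIntegral.integral_same, mul_zero, Real.exp_zero] at this
  linarith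

lemma intervalIntegrable_clm_apply {E : Type*} [NormedAddCommGroup E] [NormedSpace ℝ E]
    {N : ℝ → E →L[ℝ] E} {p q : ℝ} (hN : IntervalIntegrable N volume p q) {u : ℝ → E}
    (hu : Continuous u) : IntervalIntegrable (fun s => N s (u s)) volume p q := by
  obtain ⟨C, hC⟩ := isCompact_uIcc.exists_bound_of_continuousOn (hu.continuousOn (s := uIcc p q))
  refine (hN.norm.const_mul C).mono_fun
    (isBoundedBilinearMap_apply.continuous.comp_aestronglyMeasurable
      (hN.aestronglyMeasurable_restrict_uIoc.prodMk hu.aestronglyMeasurable)) ?_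
  rw [Filter.EventuallyLE, ae_restrict_iff' measurableSet_uIoc]
  refine .of_forall fun s hs => ((N s).le_opNorm _).trans ?_
  rw [mul_comm, norm_mul, norm_norm]
  gcongr
  exact (hC s (uIoc_subset_uIcc hs)).trans (le_abs_self C)

/-- Linear Volterra equations with locally integrable coefficients have global solutions. -/
theorem exists_volterra_solution {N : ℝ → E →L[ℝ] E} (hN : ∀ p q, IntervalIntegrable N volume p q)
    {a : ℝ} (ha : ∀ x, x ≤ a → N x = 0) (y₀ : E) :
    ∃ y : ℝ → E, Continuous y ∧ ∀ x, y x = y₀ + ∫ s in a..x, N s (y s) := by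
  set k : ℝ → ℝ := fun x => ∫ t in a..x, ‖N t‖ with hk
  have hkc : Continuous k := intervalIntegral.continuous_primitive (fun p q => (hN p q).norm) a
  have hint : ∀ u : ℝ → E, Continuous u → ∀ p q,
      IntervalIntegrable (fun s => N s (u s)) volume p q := fun u hu p q =>
    intervalIntegrable_clm_apply (hN p q) hu
  have hpc : ∀ u : ℝ → E, Continuous u → Continuous fun x => ∫ s in a..x, N s (u s) := fun u hu =>
    intervalIntegral.continuous_primitive (hint u hu) a
  have hleft : ∀ x ≤ a, ∀ f : ℝ → E, ∫ s in a..x, N s (f s) = 0 := by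
    intro x hx f
    rw [intervalIntegral.integral_symm, intervalIntegral.integral_of_le hx,
      setIntegral_eq_zero_of_forall_eq_zero, neg_zero]
    intro s hs
    rw [ha s hs.2]
    rfl
  have hkpos : ∀ x, 0 ≤ k x := by
    intro x
    rcases le_total a x with h | h
    · exact intervalIntegral.integral_nonneg h fun _ _ => norm_nonneg _
    · refine le_of_eq ?_
      rw [hk]
      dsimp only
      rw [intervalIntegral.integral_symm, intervalIntegral.integral_of_le h,
        setIntegral_eq_zero_of_forall_eq_zero, neg_zero]
      intro s hs
      rw [ha s hs.2, norm_zero]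
  -- The weight exp(-2k) makes the integral operator a contraction on the whole line at once, so no
  -- gluing of local solutions is needed.
  have hbound : ∀ u : ℝ →ᵇ E, ∀ x, ‖Real.exp (-(2 * k x)) •
      ∫ s in a..x, N s (Real.exp (2 * k s) • u s)‖ ≤ 1 / 2 * ‖u‖ := by
    intro u x
    rcases le_total a x with h | h
    · obtain ⟨h1, h2⟩ := integral_norm_mul_exp hN h
      have : ‖∫ s in a..x, N s (Real.exp (2 * k s) • u s)‖ ≤
          ‖u‖ * ((Real.exp (2 * k x) - 1) / 2) := by
        rw [← h2, ← intervalIntegral.integral_const_mul]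
        refine intervalIntegral.norm_integral_le_of_norm_le h (.of_forall fun s _ => ?_)
          (h1.const_mul _)
        refine ((N s).le_opNorm _).trans ?_
        rw [norm_smul, Real.norm_of_nonneg (Real.exp_pos _).le]
        calc _ ≤ ‖N s‖ * (Real.exp (2 * k s) * ‖u‖) := by gcongr; exact u.norm_coe_le_norm s
          _ = _ := by ring
      rw [norm_smul, Real.norm_of_nonneg (Real.exp_pos _).le]
      calc _ ≤ Real.exp (-(2 * k x)) * (‖u‖ * ((Real.exp (2 * k x) - 1) / 2)) := by gcongr
        _ = ‖u‖ / 2 * (Real.exp (-(2 * k x)) * Real.exp (2 * k x) - Real.exp (-(2 * k x))) := by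
          ring
        _ ≤ ‖u‖ / 2 * (1 - 0) := by
          rw [← Real.exp_add, neg_add_cancel, Real.exp_zero]
          gcongr
          positivity
        _ = _ := by ring
    · rw [hleft x h, smul_zero, norm_zero]
      positivity
  -- The unknown is the rescaled function u = exp(-2k) y, which stays bounded although y itself may
  -- grow.
  let T : (ℝ →ᵇ E) → (ℝ →ᵇ E) := fun u => BoundedContinuousFunction.ofNormedAddCommGroup
    (fun x => Real.exp (-(2 * k x)) • (y₀ + ∫ s in a..x, N s (Real.exp (2 * k s) • u s)))
    (by
      have := hpc (fun s => Real.exp (2 * k s) • u s) (by fun_prop)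
      fun_prop)
    (‖y₀‖ + 1 / 2 * ‖u‖) (fun x => by
      rw [smul_add]
      refine (norm_add_le _ _).trans (add_le_add ?_ (hbound u x))
      rw [norm_smul, Real.norm_of_nonneg (Real.exp_pos _).le]
      refine mul_le_of_le_one_left (norm_nonneg _) (Real.exp_le_one_iff.2 ?_)
      linarith [hkpos x])
  have hT : ContractingWith (1 / 2) T := by
    refine ⟨by norm_num, LipschitzWith.of_dist_le_mul fun u v => ?_⟩
    rw [BoundedContinuousFunction.dist_le (by positivity)]
    intro x
    have h2 := hbound (u - v) x
    have e : T u x - T v x = Real.exp (-(2 * k x)) •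
        ∫ s in a..x, N s (Real.exp (2 * k s) • (u - v) s) := by
      change Real.exp (-(2 * k x)) • (y₀ + ∫ s in a..x, N s (Real.exp (2 * k s) • u s)) -
      Real.exp (-(2 * k x)) • (y₀ + ∫ s in a..x, N s (Real.exp (2 * k s) • v s)) = _
      rw [← smul_sub, add_sub_add_left_eq_sub, ← intervalIntegral.integral_sub
        (hint _ (by fun_prop) _ _) (hint _ (by fun_prop) _ _)]
      congr 2
      funext s
      rw [← map_sub, ← smul_sub]
      rfl
    rw [dist_eq_norm, dist_eq_norm, e]
    simpa using h2
  obtain ⟨u, hu, -⟩ := hT.exists_fixedPoint 0 (edist_ne_top _ _)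
  refine ⟨fun x => Real.exp (2 * k x) • u x, by fun_prop, fun x => ?_⟩
  have h := DFunLike.congr_fun hu x
  have e : T u x = Real.exp (-(2 * k x)) •
    (y₀ + ∫ s in a..x, N s (Real.exp (2 * k s) • u s)) := rfl
  dsimp only
  conv_lhs => rw [← h, e]
  rw [smul_smul, ← Real.exp_add, add_neg_cancel, Real.exp_zero, one_smul]

end Volterra

noncomputable section

/-! ### The form u*Jv and a weighted Cauchy–Schwarz inequality -/

section Forms

lemma star_mulVec_dotProduct {p q : Type*} [Fintype p] [Fintype q] (M : Matrix p q ℂ)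
    (u : q → ℂ) (v : p → ℂ) : star (M *ᵥ u) ⬝ᵥ v = star u ⬝ᵥ (Mᴴ *ᵥ v) := by
  rw [star_mulVec, dotProduct_mulVec]

lemma conjTranspose_J (m : ℕ) : (Matrix.J (Fin m) ℂ)ᴴ = -Matrix.J (Fin m) ℂ := by
  rw [conjTranspose, J_transpose]
  ext i j
  rcases i with i | i <;> rcases j with j | j <;> simp [J, Matrix.one_apply, apply_ite]

lemma J_mulVec_J {m : ℕ} (u : CVec m) :
    Matrix.J (Fin m) ℂ *ᵥ (Matrix.J (Fin m) ℂ *ᵥ u) = -u := by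
  rw [mulVec_mulVec, J_squared, neg_mulVec, one_mulVec]

/-- The skew-Hermitian form `u* J v`. -/
def jform {m : ℕ} (u v : CVec m) : ℂ := star u ⬝ᵥ (Matrix.J (Fin m) ℂ *ᵥ v)

lemma jform_eq_neg {m : ℕ} (u v : CVec m) :
    jform u v = -(star (Matrix.J (Fin m) ℂ *ᵥ u) ⬝ᵥ v) := by
  rw [star_mulVec_dotProduct, conjTranspose_J, neg_mulVec, dotProduct_neg, neg_neg, jform]

/-- Positivity of the form at tw - v bounds the real part of w*Wv; rotating u by a phase replaces
the real part by the modulus. -/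
lemma Matrix.PosSemidef.norm_dotProduct_le {n : Type*} [Fintype n] {W : Matrix n n ℂ}
    (hW : W.PosSemidef) {t : ℝ} (ht : 0 < t) (u v : n → ℂ) :
    ‖star u ⬝ᵥ (W *ᵥ v)‖ ≤
      (t * (star u ⬝ᵥ (W *ᵥ u)).re + t⁻¹ * (star v ⬝ᵥ (W *ᵥ v)).re) / 2 := by
  have key : ∀ w : n → ℂ, 2 * (star w ⬝ᵥ (W *ᵥ v)).re ≤
      t * (star w ⬝ᵥ (W *ᵥ w)).re + t⁻¹ * (star v ⬝ᵥ (W *ᵥ v)).re := by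
    intro w
    have h := hW.re_dotProduct_nonneg ((t : ℂ) • w - v)
    have hs : star v ⬝ᵥ (W *ᵥ w) = star (star w ⬝ᵥ (W *ᵥ v)) := by
      rw [← star_dotProduct_star, star_star, star_mulVec_dotProduct, hW.isHermitian.eq]
    have h2 : 0 ≤ t * (t * (star w ⬝ᵥ (W *ᵥ w)).re) - 2 * t * (star w ⬝ᵥ (W *ᵥ v)).re +
        (star v ⬝ᵥ (W *ᵥ v)).re := by
      simp only [star_sub, star_smul, mulVec_sub, mulVec_smul, sub_dotProduct, dotProduct_sub,
        smul_dotProduct, dotProduct_smul, hs, smul_eq_mul, Complex.star_def, Complex.conj_ofReal,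
        RCLike.re_to_complex, Complex.sub_re, Complex.re_ofReal_mul, Complex.conj_re] at h
      linarith
    have h3 : 0 ≤ t⁻¹ * (t * (t * (star w ⬝ᵥ (W *ᵥ w)).re) -
        2 * t * (star w ⬝ᵥ (W *ᵥ v)).re + (star v ⬝ᵥ (W *ᵥ v)).re) := by positivity
    have e : t⁻¹ * (t * (t * (star w ⬝ᵥ (W *ᵥ w)).re) -
        2 * t * (star w ⬝ᵥ (W *ᵥ v)).re + (star v ⬝ᵥ (W *ᵥ v)).re) =
        t * (star w ⬝ᵥ (W *ᵥ w)).re - 2 * (star w ⬝ᵥ (W *ᵥ v)).re +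
        t⁻¹ * (star v ⬝ᵥ (W *ᵥ v)).re := by field_simp
    rw [e] at h3
    linarith
  set z := star u ⬝ᵥ (W *ᵥ v) with hz
  rcases eq_or_ne z 0 with h0 | h0
  · have := key 0
    have h1 := hW.re_dotProduct_nonneg u
    have h2 := hW.re_dotProduct_nonneg v
    simp only [RCLike.re_to_complex] at h1 h2
    rw [h0, norm_zero]
    positivity
  · have h1 : ‖z‖ ≠ 0 := norm_ne_zero_iff.2 h0
    -- The phase is chosen so that the rotated product equals ‖z‖, while u*Wu is unchanged.
    have e := key ((z / ‖z‖) • u)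
    simp only [star_smul, mulVec_smul, smul_dotProduct, dotProduct_smul, ← hz, smul_eq_mul] at e
    have e1 : star (z / (‖z‖ : ℂ)) * z = ((‖z‖ : ℝ) : ℂ) := by
      rw [Complex.star_def, map_div₀, Complex.conj_ofReal, div_mul_eq_mul_div,
        ← Complex.normSq_eq_conj_mul_self, Complex.normSq_eq_norm_sq]
      push_cast
      field_simp
    have e2 : star (z / (‖z‖ : ℂ)) * (z / ‖z‖) = 1 := by
      rw [← mul_div_assoc, e1, div_self (by exact_mod_cast h1)]
    rw [e1, ← mul_assoc, mul_comm (z / (‖z‖ : ℂ)), e2, one_mul, Complex.ofReal_re] at e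
    linarith

end Forms

/-! ### The form u*Av and the spaces L²_A -/

namespace HamiltonianSystem

variable {m r : ℕ} {a : ℝ} (S : HamiltonianSystem m r a)

/-- The form `u* A(x) v`. -/
def aform (x : ℝ) (u v : CVec m) : ℂ := star u ⬝ᵥ (S.A x *ᵥ v)

lemma aform_eq (x : ℝ) (u v : CVec m) :
    S.aform x u v = star (hatE m r *ᵥ u) ⬝ᵥ (S.W x *ᵥ (hatE m r *ᵥ v)) := by
  rw [aform, A, star_mulVec_dotProduct, mulVec_mulVec, mulVec_mulVec, Matrix.mul_assoc]

lemma normSqA_eq (s : Set ℝ) (F : ℝ → CVec m) :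
    S.normSqA s F = ∫⁻ x in s, ENNReal.ofReal (S.aform x (F x) (F x)).re := by
  simp only [normSqA, normSqW, aform_eq]

lemma ae_posDef {s : Set ℝ} (hs : s ⊆ Ioi a) : ∀ᵐ x ∂volume.restrict s, (S.W x).PosDef :=
  ae_restrict_of_ae_restrict_of_subset hs S.W_posDef

lemma aform_re_nonneg {x : ℝ} (hx : (S.W x).PosDef) (u : CVec m) : 0 ≤ (S.aform x u u).re := by
  rw [aform_eq]
  exact hx.posSemidef.re_dotProduct_nonneg _

lemma norm_aform_le {x : ℝ} (hx : (S.W x).PosDef) {t : ℝ} (ht : 0 < t) (u v : CVec m) :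
    ‖S.aform x u v‖ ≤ (t * (S.aform x u u).re + t⁻¹ * (S.aform x v v).re) / 2 := by
  simp only [aform_eq]
  exact hx.posSemidef.norm_dotProduct_le ht _ _

lemma conjTranspose_A {x : ℝ} (hx : (S.W x).PosDef) : (S.A x)ᴴ = S.A x := by
  rw [A, conjTranspose_mul, conjTranspose_mul, conjTranspose_conjTranspose, hx.isHermitian.eq,
    Matrix.mul_assoc]

lemma aestronglyMeasurable_aform {s : Set ℝ} (hs : s ⊆ Ioi a) {F G : ℝ → CVec m}
    (hF : AEStronglyMeasurable F (volume.restrict s))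
    (hG : AEStronglyMeasurable G (volume.restrict s)) :
    AEStronglyMeasurable (fun x => S.aform x (F x) (G x)) (volume.restrict s) := by
  simp only [aform_eq, dotProduct, mulVec, Pi.star_apply]
  have hW := fun i j => S.aemeasurable_W hs i j
  have hc : ∀ {H : ℝ → CVec m}, AEStronglyMeasurable H (volume.restrict s) →
      ∀ k, AEStronglyMeasurable (fun x => ∑ i, hatE m r k i * H x i) (volume.restrict s) := by
    intro H hH k
    refine Finset.aestronglyMeasurable_fun_sum _ fun i _ => ?_
    exact ((continuous_apply i).comp_aestronglyMeasurable hH).const_mul _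
  refine Finset.aestronglyMeasurable_fun_sum _ fun i _ => ?_
  exact (continuous_star.comp_aestronglyMeasurable (hc hF i)).mul
    (Finset.aestronglyMeasurable_fun_sum _ fun j _ => (hW i j).mul (hc hG j))

lemma MemL2A.mono {S : HamiltonianSystem m r a} {s t : Set ℝ} (hst : s ⊆ t) {F : ℝ → CVec m}
    (hF : S.MemL2A t F) : S.MemL2A s F :=
  ⟨hF.1.mono_set hst, (lintegral_mono_set hst).trans_lt hF.2⟩

lemma MemL2A.congr {S : HamiltonianSystem m r a} {s : Set ℝ} {F G : ℝ → CVec m}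
    (hF : S.MemL2A s F) (h : F =ᵐ[volume.restrict s] G) : S.MemL2A s G :=
  ⟨hF.1.congr h, by rw [← S.normSqA_congr h]; exact hF.2⟩

lemma integrableOn_aform_re {s : Set ℝ} (hs : s ⊆ Ioi a) {F : ℝ → CVec m} (hF : S.MemL2A s F) :
    IntegrableOn (fun x => (S.aform x (F x) (F x)).re) s := by
  have hm := Complex.continuous_re.comp_aestronglyMeasurable
    (S.aestronglyMeasurable_aform hs hF.1 hF.1)
  refine ⟨hm, ?_⟩
  rw [hasFiniteIntegral_iff_ofReal
    ((S.ae_posDef hs).mono fun x hx => S.aform_re_nonneg hx _), ← normSqA_eq]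
  exact hF.2

lemma integral_aform_re {s : Set ℝ} (hs : s ⊆ Ioi a) {F : ℝ → CVec m} (hF : S.MemL2A s F) :
    ∫ x in s, (S.aform x (F x) (F x)).re = (S.normSqA s F).toReal := by
  rw [integral_eq_lintegral_of_nonneg_ae
    ((S.ae_posDef hs).mono fun x hx => S.aform_re_nonneg hx _)
    (S.integrableOn_aform_re hs hF).1, normSqA_eq]

lemma integrableOn_aform {s : Set ℝ} (hs : s ⊆ Ioi a) {F G : ℝ → CVec m} (hF : S.MemL2A s F)
    (hG : S.MemL2A s G) : IntegrableOn (fun x => S.aform x (F x) (G x)) s := by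
  refine Integrable.mono' (((S.integrableOn_aform_re hs hF).const_mul 1).add
    ((S.integrableOn_aform_re hs hG).const_mul 1⁻¹) |>.div_const 2)
    (S.aestronglyMeasurable_aform hs hF.1 hG.1) ?_
  filter_upwards [S.ae_posDef hs] with x hx
  exact S.norm_aform_le hx one_pos _ _

/-- The free weight t allows the contribution of one factor to be made small and absorbed, as in the
isotropy argument. -/
lemma norm_integral_aform_le {s : Set ℝ} (hs : s ⊆ Ioi a) {F G : ℝ → CVec m}
    (hF : S.MemL2A s F) (hG : S.MemL2A s G) {t : ℝ} (ht : 0 < t) :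
    ‖∫ x in s, S.aform x (F x) (G x)‖ ≤
      (t * (S.normSqA s F).toReal + t⁻¹ * (S.normSqA s G).toReal) / 2 := by
  rw [← S.integral_aform_re hs hF, ← S.integral_aform_re hs hG, ← integral_const_mul,
    ← integral_const_mul, ← integral_add ((S.integrableOn_aform_re hs hF).const_mul t)
    ((S.integrableOn_aform_re hs hG).const_mul t⁻¹), ← integral_div]
  refine norm_integral_le_of_norm_le (((S.integrableOn_aform_re hs hF).const_mul t).add
    ((S.integrableOn_aform_re hs hG).const_mul t⁻¹) |>.div_const 2) ?_
  filter_upwards [S.ae_posDef hs] with x hx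
  exact S.norm_aform_le hx ht _ _

lemma integrableOn_W {p q : ℝ} (hp : a ≤ p) (i j : Fin r) :
    IntegrableOn (fun x => S.W x i j) (Icc p q) :=
  (S.W_int i j).integrableOn_compact_subset (fun _ hx => hp.trans hx.1) isCompact_Icc

/-- Continuous functions are in `L²_A` on bounded intervals. -/
lemma memL2A_of_continuousOn {p q : ℝ} (hp : a ≤ p) {F : ℝ → CVec m}
    (hF : ContinuousOn F (Icc p q)) : S.MemL2A (Ioo p q) F := by
  have hs : Ioo p q ⊆ Ioi a := fun x hx => hp.trans_lt hx.1
  have hm : AEStronglyMeasurable F (volume.restrict (Ioo p q)) :=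
    (hF.aestronglyMeasurable measurableSet_Icc).mono_set Ioo_subset_Icc_self
  refine ⟨hm, ?_⟩
  have hint : IntegrableOn (fun x => S.aform x (F x) (F x)) (Icc p q) := by
    simp only [aform_eq, dotProduct, Pi.star_apply]
    have hc : ∀ k, ContinuousOn (fun x => (hatE m r *ᵥ F x) k) (Icc p q) := fun k =>
      ((continuous_apply k).comp (continuous_mulVec (hatE m r))).comp_continuousOn hF
    refine integrable_finsetSum _ fun i _ => ?_
    refine IntegrableOn.continuousOn_mul (continuous_star.comp_continuousOn (hc i)) ?_
      isCompact_Icc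
    have : IntegrableOn (fun x => ∑ j, S.W x i j * (hatE m r *ᵥ F x) j) (Icc p q) :=
      integrable_finsetSum _ fun j _ =>
        (S.integrableOn_W hp i j).mul_continuousOn (hc j) isCompact_Icc
    exact this
  have h2 : IntegrableOn (fun x => (S.aform x (F x) (F x)).re) (Ioo p q) :=
    (hint.mono_set Ioo_subset_Icc_self).re
  have := h2.2
  rw [hasFiniteIntegral_iff_ofReal
    ((S.ae_posDef hs).mono fun x hx => S.aform_re_nonneg hx _)] at this
  rw [normSqA_eq]
  exact this

end HamiltonianSystem

/-! ### Differentiating u*Jv along absolutely continuous functions -/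

section Forms

lemma AbsolutelyContinuousOnInterval.finset_sum {ι E : Type*} [NormedAddCommGroup E]
    {p q : ℝ} (s : Finset ι) {f : ι → ℝ → E}
    (hf : ∀ i ∈ s, AbsolutelyContinuousOnInterval (f i) p q) :
    AbsolutelyContinuousOnInterval (fun x => ∑ i ∈ s, f i x) p q := by
  classical
  induction s using Finset.induction_on with
  | empty =>
    simpa using (LipschitzWith.const (0 : E)).lipschitzOnWith.absolutelyContinuousOnInterval
  | insert i s hi ih =>
    simp only [Finset.sum_insert hi]
    exact (hf i (by simp)).fun_add (ih fun j hj => hf j (by simp [hj]))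

variable {m : ℕ} {F G : ℝ → CVec m} {p q : ℝ}

lemma AbsolutelyContinuousOnInterval.eval (hF : AbsolutelyContinuousOnInterval F p q)
    (i : Fin m ⊕ Fin m) : AbsolutelyContinuousOnInterval (fun x => F x i) p q :=
  hF.of_dist_le (C := 1) fun x _ y _ => by rw [one_mul]; exact dist_le_pi_dist _ _ i

lemma AbsolutelyContinuousOnInterval.jform (hF : AbsolutelyContinuousOnInterval F p q)
    (hG : AbsolutelyContinuousOnInterval G p q) :
    AbsolutelyContinuousOnInterval (fun x => jform (F x) (G x)) p q := by
  simp only [_root_.jform, dotProduct, mulVec]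
  refine .finset_sum _ fun i _ => ?_
  have h1 : AbsolutelyContinuousOnInterval (fun x => star (F x) i) p q :=
    (hF.eval i).of_dist_le (C := 1) fun x _ y _ => by
      rw [one_mul, Pi.star_apply, Pi.star_apply, dist_star_star]
  have h2 : AbsolutelyContinuousOnInterval
      (fun x => ∑ j, Matrix.J (Fin m) ℂ i j * G x j) p q :=
    .finset_sum _ fun j _ => (hG.eval j).const_smul (Matrix.J (Fin m) ℂ i j)
  exact h1.fun_smul h2

lemma hasDerivAt_jform {F' G' : CVec m} {x : ℝ} (hF : HasDerivAt F F' x)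
    (hG : HasDerivAt G G' x) :
    HasDerivAt (fun y => jform (F y) (G y)) (jform F' (G x) + jform (F x) G') x := by
  simp only [jform, dotProduct, mulVec, ← Finset.sum_add_distrib]
  refine HasDerivAt.fun_sum fun i _ => ?_
  refine HasDerivAt.fun_mul ?_ (HasDerivAt.fun_sum fun j _ => ?_)
  · exact (hasDerivAt_pi.1 hF i).star
  · exact (hasDerivAt_pi.1 hG j).const_mul _

lemma AbsolutelyContinuousOnInterval.ae_hasDerivAt (hpq : p ≤ q)
    (hF : AbsolutelyContinuousOnInterval F p q) :
    ∀ᵐ x ∂volume.restrict (Ioo p q), HasDerivAt F (deriv F x) x := by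
  rw [ae_restrict_iff' measurableSet_Ioo]
  filter_upwards [hF.boundedVariationOn.ae_differentiableAt_of_mem_uIcc] with x hx h
  refine (hx ?_).hasDerivAt
  rw [uIcc_of_le hpq]
  exact Ioo_subset_Icc_self h

end Forms

/-! ### Inhomogeneous equations and Lagrange's identity -/

namespace HamiltonianSystem

variable {m r : ℕ} {a : ℝ} (S : HamiltonianSystem m r a)

/-- `J F' = B F + A k` a.e. on `s`. -/
def SolvesOn (s : Set ℝ) (F k : ℝ → CVec m) : Prop :=
  ∀ᵐ x ∂volume.restrict s,
    Matrix.J (Fin m) ℂ *ᵥ deriv F x = S.B x *ᵥ F x + S.A x *ᵥ k x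

lemma isSolution_iff {z : ℂ} {F : ℝ → CVec m} : S.IsSolution z F ↔
    (∀ d, a ≤ d → AbsolutelyContinuousOnInterval F a d) ∧ S.SolvesOn (Ioi a) F (z • F) := by
  simp only [IsSolution, SolvesOn, add_mulVec, smul_mulVec, Pi.smul_apply, mulVec_smul, add_comm]

lemma SolvesOn.mono {S : HamiltonianSystem m r a} {s t : Set ℝ} (hst : s ⊆ t) {F k : ℝ → CVec m}
    (h : S.SolvesOn t F k) : S.SolvesOn s F k :=
  ae_restrict_of_ae_restrict_of_subset hst h

lemma SolvesOn.sub {S : HamiltonianSystem m r a} {p q : ℝ} (hpq : p ≤ q) {F G k l : ℝ → CVec m}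
    (hF : AbsolutelyContinuousOnInterval F p q) (hG : AbsolutelyContinuousOnInterval G p q)
    (h1 : S.SolvesOn (Ioo p q) F k) (h2 : S.SolvesOn (Ioo p q) G l) :
    S.SolvesOn (Ioo p q) (F - G) (k - l) := by
  filter_upwards [h1, h2, hF.ae_hasDerivAt hpq, hG.ae_hasDerivAt hpq] with x e1 e2 d1 d2
  rw [(d1.sub d2).deriv, mulVec_sub, e1, e2, Pi.sub_apply, Pi.sub_apply, mulVec_sub, mulVec_sub]
  abel

/-- Lagrange's identity. -/
lemma jform_eq_add_integral {p q : ℝ} (hp : a ≤ p) (hpq : p ≤ q) {F G f g : ℝ → CVec m}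
    (hF : AbsolutelyContinuousOnInterval F p q) (hG : AbsolutelyContinuousOnInterval G p q)
    (hFf : S.SolvesOn (Ioo p q) F f) (hGg : S.SolvesOn (Ioo p q) G g)
    (hf : S.MemL2A (Ioo p q) f) (hg : S.MemL2A (Ioo p q) g) :
    jform (F q) (G q) = jform (F p) (G p) +
      (∫ x in Ioo p q, S.aform x (F x) (g x)) - ∫ x in Ioo p q, S.aform x (f x) (G x) := by
  have hs : Ioo p q ⊆ Ioi a := fun x hx => hp.trans_lt hx.1
  have mF : S.MemL2A (Ioo p q) F := S.memL2A_of_continuousOn hp (by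
    have := hF.continuousOn; rwa [uIcc_of_le hpq] at this)
  have mG : S.MemL2A (Ioo p q) G := S.memL2A_of_continuousOn hp (by
    have := hG.continuousOn; rwa [uIcc_of_le hpq] at this)
  have i1 := S.integrableOn_aform hs mF hg
  have i2 := S.integrableOn_aform hs hf mG
  rw [add_sub_assoc, ← integral_sub i1 i2, ← integral_Ioc_eq_integral_Ioo,
    ← intervalIntegral.integral_of_le hpq]
  refine (hF.jform hG).eq_add_integral hpq ?_ ?_
  · rw [intervalIntegrable_iff_integrableOn_Ioo_of_le hpq]
    exact i1.sub i2
  · filter_upwards [hFf, hGg, hF.ae_hasDerivAt hpq, hG.ae_hasDerivAt hpq, S.ae_posDef hs,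
      ae_restrict_of_ae_restrict_of_subset hs S.B_herm] with x e1 e2 d1 d2 hW hB
    refine (hasDerivAt_jform d1 d2).congr_deriv ?_
    -- After JF' and JG' are substituted, the two terms with B cancel since B = B*; A = A* leaves
    -- F*Ag - f*AG.
    rw [jform_eq_neg, e1, jform, e2]
    simp only [star_add, add_dotProduct, dotProduct_add, star_mulVec_dotProduct, hB.eq,
      S.conjTranspose_A hW, aform]
    ring

end HamiltonianSystem

lemma isUnit_of_mulVec_eq_zero {n : Type*} [Fintype n] [DecidableEq n] {M : Matrix n n ℂ}
    (h : ∀ v, M *ᵥ v = 0 → v = 0) : IsUnit M := by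
  rw [← Matrix.mulVec_injective_iff_isUnit]
  intro u v huv
  rw [← sub_eq_zero]
  refine h _ ?_
  rw [mulVec_sub]
  exact sub_eq_zero.2 huv

/-! ### Existence, uniqueness and the fundamental matrix -/

namespace HamiltonianSystem

variable {m r : ℕ} {a : ℝ} (S : HamiltonianSystem m r a)

/-- A square matrix as a real-linear continuous operator. -/
def mulVecCLM (m : ℕ) :
    (Fin m ⊕ Fin m → Fin m ⊕ Fin m → ℂ) →L[ℝ] (CVec m →L[ℝ] CVec m) :=
  LinearMap.toContinuousLinearMap
    { toFun := fun M => LinearMap.toContinuousLinearMap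
        ((Matrix.mulVecLin (Matrix.of M)).restrictScalars ℝ)
      map_add' := fun M N => by
        ext v i
        simp [← Matrix.of_add_of]
      map_smul' := fun t M => by
        ext v i
        simp [← Matrix.smul_of] }

/-- The coefficient matrix of the system in the form `F' = -J (z A + B) F`. -/
def coeff (z : ℂ) (x : ℝ) : Matrix (Fin m ⊕ Fin m) (Fin m ⊕ Fin m) ℂ :=
  -(Matrix.J (Fin m) ℂ * (z • S.A x + S.B x))

lemma locallyIntegrableOn_coeff (z : ℂ) (i j : Fin m ⊕ Fin m) :
    LocallyIntegrableOn (fun x => S.coeff z x i j) (Ici a) volume := by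
  have hsum : ∀ {ι : Type} (s : Finset ι) (f : ι → ℝ → ℂ),
      (∀ i ∈ s, LocallyIntegrableOn (f i) (Ici a) volume) →
      LocallyIntegrableOn (fun x => ∑ i ∈ s, f i x) (Ici a) volume := by
    intro ι s f hf
    rw [locallyIntegrableOn_iff isClosed_Ici.isLocallyClosed]
    intro k hk hkc
    exact integrable_finsetSum _ fun i hi => (hf i hi).integrableOn_compact_subset hk hkc
  have hconst : ∀ (c : ℂ) (f : ℝ → ℂ), LocallyIntegrableOn f (Ici a) volume →
      LocallyIntegrableOn (fun x => c * f x) (Ici a) volume := fun c f hf => hf.smul c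
  have hA : ∀ i j, LocallyIntegrableOn (fun x => S.A x i j) (Ici a) volume := by
    intro i j
    simp only [A, Matrix.mul_apply, Finset.sum_mul]
    refine hsum _ _ fun k _ => hsum _ _ fun l _ => ?_
    have := hconst ((hatE m r)ᴴ i l * hatE m r k j) _ (S.W_int l k)
    convert this using 2
    ring
  have : (fun x => S.coeff z x i j) = fun x => ∑ k, (-Matrix.J (Fin m) ℂ i k) *
      (z * S.A x k j + S.B x k j) := by
    funext x
    simp [coeff, Matrix.mul_apply]
  rw [this]
  exact hsum _ _ fun k _ => hconst _ _ ((hconst z _ (hA k j)).add (S.B_int k j))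

/-- Since J² = -1, the system reads F' = -J(zA + B)F. Cutting the coefficient off to the left of a
makes it integrable on every bounded interval, so the Volterra theorem applies; the equation then
holds a.e. by Lebesgue differentiation. -/
theorem exists_solution (z : ℂ) (v : CVec m) : ∃ F, S.IsSolution z F ∧ F a = v := by
  set N : ℝ → CVec m →L[ℝ] CVec m := (Ioi a).indicator fun x => mulVecCLM m fun i j => S.coeff z x i j with hN
  have hint : ∀ d, a ≤ d → IntegrableOn (fun x => mulVecCLM m fun i j => S.coeff z x i j) (Icc a d) := by
    intro d _
    refine ContinuousLinearMap.integrable_comp _ (Integrable.of_eval fun i => ?_)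
    exact Integrable.of_eval fun j => (S.locallyIntegrableOn_coeff z i j).integrableOn_compact_subset
      (fun x hx => hx.1) isCompact_Icc
  have hNint : ∀ p q, IntervalIntegrable N volume p q := by
    intro p q
    have h1 : IntegrableOn N (Icc a (max a (max p q))) :=
      IntegrableOn.indicator (hint _ (le_max_left _ _)) measurableSet_Ioi
    have h2 : IntegrableOn N (Iic a) := by
      refine integrableOn_zero.congr_fun (fun x hx => ?_) measurableSet_Iic
      rw [hN, indicator_of_notMem (by simpa using hx)]
    have h3 := h2.union h1
    rw [intervalIntegrable_iff]
    refine h3.mono_set fun x hx => ?_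
    rcases le_total x a with h | h
    · exact Or.inl h
    · refine Or.inr ⟨h, ?_⟩
      rw [uIoc, mem_Ioc] at hx
      exact hx.2.trans (le_max_right _ _)
  obtain ⟨y, hyc, hy⟩ := exists_volterra_solution hNint (a := a)
    (fun x hx => by rw [hN, indicator_of_notMem (by simpa using hx)]) v
  have hya : y a = v := by rw [hy a, intervalIntegral.integral_same, add_zero]
  have hNy : ∀ p q, IntervalIntegrable (fun s => N s (y s)) volume p q := fun p q =>
    intervalIntegrable_clm_apply (hNint p q) hyc
  have hae : ∀ᵐ x, HasDerivAt y (N x (y x)) x := by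
    have h1 : ∀ n : ℕ, ∀ᵐ x : ℝ, x ∈ Ioo (-(n : ℝ)) n → HasDerivAt y (N x (y x)) x := by
      intro n
      filter_upwards [(hNy (-(n : ℝ)) n).ae_hasDerivAt_integral] with x hx h
      have hn : -(n : ℝ) ≤ n := (h.1.trans h.2).le
      have := (hx (by rw [uIcc_of_le hn]; exact Ioo_subset_Icc_self h) (-(n : ℝ))
        left_mem_uIcc).const_add (y (-(n : ℝ)))
      refine this.congr_of_eventuallyEq (.of_forall fun t => ?_)
      dsimp only
      rw [hy t, hy (-(n : ℝ)), add_assoc,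
        intervalIntegral.integral_add_adjacent_intervals (hNy _ _) (hNy _ _)]
    filter_upwards [ae_all_iff.2 h1] with x hx
    obtain ⟨n, hn⟩ := exists_nat_gt |x|
    exact hx n (abs_lt.1 hn)
  refine ⟨y, ⟨fun d hd => ?_, ?_⟩, hya⟩
  · refine (absolutelyContinuousOnInterval_integral (hNy a d)).of_dist_le (C := 1)
      fun s _ t _ => ?_
    rw [hy s, hy t, dist_add_left, one_mul]
  · rw [ae_restrict_iff' measurableSet_Ioi]
    filter_upwards [hae] with x hx h
    have hNx : N x = mulVecCLM m fun i j => S.coeff z x i j := by rw [hN, indicator_of_mem h]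
    rw [hx.deriv, hNx]
    change Matrix.J (Fin m) ℂ *ᵥ (S.coeff z x *ᵥ y x) = _
    rw [coeff, neg_mulVec, mulVec_neg, ← mulVec_mulVec, J_mulVec_J, neg_neg]

lemma IsSolution.ac {S : HamiltonianSystem m r a} {z : ℂ} {F : ℝ → CVec m}
    (hF : S.IsSolution z F) {p q : ℝ} (hp : a ≤ p) (hpq : p ≤ q) :
    AbsolutelyContinuousOnInterval F p q :=
  (hF.1 q (hp.trans hpq)).mono (by
    rw [uIcc_of_le hpq, uIcc_of_le (hp.trans hpq)]
    exact Icc_subset_Icc_left hp)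

lemma IsSolution.solvesOn {S : HamiltonianSystem m r a} {z : ℂ} {F : ℝ → CVec m}
    (hF : S.IsSolution z F) : S.SolvesOn (Ioi a) F (z • F) := (S.isSolution_iff.1 hF).2

lemma IsSolution.add {S : HamiltonianSystem m r a} {z : ℂ} {F G : ℝ → CVec m}
    (hF : S.IsSolution z F) (hG : S.IsSolution z G) : S.IsSolution z (F + G) := by
  refine ⟨fun d hd => (hF.1 d hd).add (hG.1 d hd), ?_⟩
  have e : ival a ⊤ = Ioi a := by ext x; simp [ival]
  have h1 := ae_differentiableAt (c := ⊤) fun d hd _ => hF.1 d hd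
  have h2 := ae_differentiableAt (c := ⊤) fun d hd _ => hG.1 d hd
  rw [e] at h1 h2
  filter_upwards [h1, h2, hF.2, hG.2] with x d1 d2 e1 e2
  rw [deriv_add d1 d2, Pi.add_apply, Matrix.mulVec_add, Matrix.mulVec_add, e1, e2]

lemma IsSolution.smul {S : HamiltonianSystem m r a} {z : ℂ} {F : ℝ → CVec m} (t : ℂ)
    (hF : S.IsSolution z F) : S.IsSolution z (t • F) := by
  refine ⟨fun d hd => (hF.1 d hd).const_smul t, ?_⟩
  filter_upwards [hF.2] with x e1
  rw [deriv_const_smul_field, Pi.smul_apply, Matrix.mulVec_smul, Matrix.mulVec_smul, e1]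

lemma isSolution_zero (z : ℂ) : S.IsSolution z 0 := by
  refine ⟨fun d _ => (LipschitzWith.const (0 : CVec m)).lipschitzOnWith.absolutelyContinuousOnInterval,
    .of_forall fun x => ?_⟩
  have : deriv (0 : ℝ → CVec m) x = 0 := by simp
  rw [this]; simp

lemma isSolution_mulVec {z : ℂ} {ι : Type} [Fintype ι] {Ψ : ℝ → Matrix (Fin m ⊕ Fin m) ι ℂ}
    (h : ∀ j, S.IsSolution z fun x i => Ψ x i j) (v : ι → ℂ) :
    S.IsSolution z fun x => Ψ x *ᵥ v := by
  classical
  have : ∀ s : Finset ι, S.IsSolution z fun x i => ∑ j ∈ s, Ψ x i j * v j := by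
    intro s
    induction s using Finset.induction_on with
    | empty =>
      simp only [Finset.sum_empty]
      exact S.isSolution_zero z
    | insert j s hj ih =>
      simp only [Finset.sum_insert hj]
      have h2 := ((h j).smul (v j)).add ih
      convert h2 using 3
      simp [mul_comm]
  exact this Finset.univ

lemma aform_smul_left (x : ℝ) (t : ℂ) (u v : CVec m) :
    S.aform x (t • u) v = star t * S.aform x u v := by
  simp [aform]

lemma aform_smul_right (x : ℝ) (t : ℂ) (u v : CVec m) :
    S.aform x u (t • v) = t * S.aform x u v := by
  simp [aform, mulVec_smul]

/-- The Wronskian of two solutions for the same real spectral parameter is constant. -/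
lemma jform_const {p q : ℝ} (hp : a ≤ p) (hpq : p ≤ q) {l : ℝ} {F G : ℝ → CVec m}
    (hF : AbsolutelyContinuousOnInterval F p q) (hG : AbsolutelyContinuousOnInterval G p q)
    (hFf : S.SolvesOn (Ioo p q) F ((l : ℂ) • F)) (hGg : S.SolvesOn (Ioo p q) G ((l : ℂ) • G)) :
    jform (F q) (G q) = jform (F p) (G p) := by
  have mF : S.MemL2A (Ioo p q) F := S.memL2A_of_continuousOn hp (by
    have := hF.continuousOn; rwa [uIcc_of_le hpq] at this)
  have mG : S.MemL2A (Ioo p q) G := S.memL2A_of_continuousOn hp (by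
    have := hG.continuousOn; rwa [uIcc_of_le hpq] at this)
  rw [S.jform_eq_add_integral hp hpq hF hG hFf hGg (mF.smul _) (mG.smul _)]
  simp only [Pi.smul_apply, aform_smul_left, aform_smul_right, Complex.star_def,
    Complex.conj_ofReal, add_sub_cancel_right]

/-- A fundamental matrix that equals the identity at `a`. -/
def fund (z : ℂ) (x : ℝ) : Matrix (Fin m ⊕ Fin m) (Fin m ⊕ Fin m) ℂ :=
  Matrix.of fun i j => (S.exists_solution z (Pi.single j 1)).choose x i

lemma isSolution_fund (z : ℂ) (v : CVec m) : S.IsSolution z fun x => S.fund z x *ᵥ v :=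
  S.isSolution_mulVec (fun j => (S.exists_solution z (Pi.single j 1)).choose_spec.1) v

lemma fund_self (z : ℂ) : S.fund z a = 1 := by
  ext i j
  rw [fund, Matrix.of_apply, (S.exists_solution z (Pi.single j 1)).choose_spec.2, Matrix.one_apply,
    Pi.single_apply]

lemma jform_fund (l : ℝ) {x : ℝ} (hx : a ≤ x) (u v : CVec m) :
    jform (S.fund l x *ᵥ u) (S.fund l x *ᵥ v) = jform u v := by
  have := S.jform_const le_rfl hx ((S.isSolution_fund l u).ac le_rfl hx)
    ((S.isSolution_fund l v).ac le_rfl hx)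
    ((S.isSolution_fund l u).solvesOn.mono Ioo_subset_Ioi_self)
    ((S.isSolution_fund l v).solvesOn.mono Ioo_subset_Ioi_self)
  rw [this, fund_self, one_mulVec, one_mulVec]

lemma jform_left_eq_zero {v : CVec m} (h : ∀ u : CVec m, jform u v = 0) : v = 0 := by
  have h1 := h (Matrix.J (Fin m) ℂ *ᵥ v)
  rw [jform] at h1
  have h2 : Matrix.J (Fin m) ℂ *ᵥ v = 0 := dotProduct_star_self_eq_zero.1 h1
  rw [← neg_eq_zero, ← J_mulVec_J, h2, mulVec_zero]

/-- The fundamental matrix preserves the nondegenerate form u*Jv, hence is injective. This precedes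
uniqueness, which is deduced from it. -/
lemma isUnit_fund (l : ℝ) {x : ℝ} (hx : a ≤ x) : IsUnit (S.fund l x) := by
  refine isUnit_of_mulVec_eq_zero fun v hv => ?_
  refine jform_left_eq_zero fun u => ?_
  rw [← S.jform_fund l hx u v, hv, jform, mulVec_zero, dotProduct_zero]

lemma exists_fund_mulVec (l : ℝ) {x : ℝ} (hx : a ≤ x) (v : CVec m) :
    ∃ u, S.fund l x *ᵥ u = v :=
  (Matrix.mulVec_surjective_iff_isUnit.2 (S.isUnit_fund l hx)) v

/-- Uniqueness for the homogeneous system with real spectral parameter. -/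
lemma eq_zero_of_solvesOn {p q : ℝ} (hp : a ≤ p) {l : ℝ} {F : ℝ → CVec m}
    (hF : AbsolutelyContinuousOnInterval F p q) (h : S.SolvesOn (Ioo p q) F ((l : ℂ) • F))
    {y : ℝ} (hy : y ∈ Icc p q) (hy0 : F y = 0) {x : ℝ} (hx : x ∈ Icc p q) : F x = 0 := by
  have hpq : p ≤ q := hx.1.trans hx.2
  -- The pairing of F with each fundamental solution is constant and vanishes at y. As the
  -- fundamental solutions span at every point, F vanishes by nondegeneracy.
  have hconst : ∀ u, ∀ t ∈ Icc p q, jform (S.fund l t *ᵥ u) (F t) =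
      jform (S.fund l p *ᵥ u) (F p) := by
    intro u t ht
    exact S.jform_const hp ht.1 ((S.isSolution_fund l u).ac hp ht.1)
      (hF.mono (by rw [uIcc_of_le ht.1, uIcc_of_le hpq]; exact Icc_subset_Icc_right ht.2))
      ((S.isSolution_fund l u).solvesOn.mono fun s hs => hp.trans_lt hs.1)
      (h.mono (Ioo_subset_Ioo_right ht.2))
  refine jform_left_eq_zero fun w => ?_
  obtain ⟨u, rfl⟩ := S.exists_fund_mulVec l (hp.trans hx.1) w
  rw [hconst u x hx, ← hconst u y hy, hy0, jform, mulVec_zero, dotProduct_zero]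

lemma eq_of_solvesOn {p q : ℝ} (hp : a ≤ p) {l : ℝ} {F G : ℝ → CVec m}
    (hF : AbsolutelyContinuousOnInterval F p q) (hFs : S.SolvesOn (Ioo p q) F ((l : ℂ) • F))
    (hG : AbsolutelyContinuousOnInterval G p q) (hGs : S.SolvesOn (Ioo p q) G ((l : ℂ) • G))
    {y : ℝ} (hy : y ∈ Icc p q) (hy0 : F y = G y) {x : ℝ} (hx : x ∈ Icc p q) : F x = G x := by
  have h := hFs.sub (hx.1.trans hx.2) hF hG hGs
  rw [← smul_sub] at h
  exact sub_eq_zero.1 (S.eq_zero_of_solvesOn hp (hF.sub hG) h hy (sub_eq_zero.2 hy0) hx)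

lemma IsSolution.eqOn {S : HamiltonianSystem m r a} {l : ℝ} {F G : ℝ → CVec m}
    (hF : S.IsSolution l F) (hG : S.IsSolution l G) {y : ℝ} (hy : a ≤ y) (h : F y = G y) {x : ℝ}
    (hx : a ≤ x) : F x = G x := by
  have hm : a ≤ max x y := hx.trans (le_max_left _ _)
  exact S.eq_of_solvesOn le_rfl (hF.ac le_rfl hm) (hF.solvesOn.mono Ioo_subset_Ioi_self)
    (hG.ac le_rfl hm) (hG.solvesOn.mono Ioo_subset_Ioi_self) ⟨hy, le_max_right _ _⟩ h
    ⟨hx, le_max_left _ _⟩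

end HamiltonianSystem

/-! ### From the operators to differential equations -/

lemma ival_top (a : ℝ) : ival a ⊤ = Ioi a := by ext x; simp [ival]

lemma ival_coe (a c : ℝ) : ival a (c : EReal) = Ioo a c := by ext x; simp [ival]

lemma hatE_mul_Er {m r : ℕ} (h : r ≤ 2 * m) : hatE m r * Er m r = hatE m r := by
  rw [Er, ← Matrix.mul_assoc, hatE_mul_conjTranspose h, Matrix.one_mul]

lemma Er_mul_Er {m r : ℕ} (h : r ≤ 2 * m) : Er m r * Er m r = Er m r := by
  calc Er m r * Er m r = (hatE m r)ᴴ * (hatE m r * Er m r) := by rw [← Matrix.mul_assoc, Er]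
    _ = Er m r := by rw [hatE_mul_Er h, Er]

namespace HamiltonianSystem

variable {m r : ℕ} {a : ℝ} (S : HamiltonianSystem m r a)

lemma A_mul_Er (x : ℝ) : S.A x * Er m r = S.A x := by
  rw [A, Matrix.mul_assoc, hatE_mul_Er S.r_le]

lemma A_mulVec_Er (x : ℝ) (v : CVec m) : S.A x *ᵥ (Er m r *ᵥ v) = S.A x *ᵥ v := by
  rw [mulVec_mulVec, A_mul_Er]

lemma C_mul_A {x : ℝ} (hx : (S.W x).PosDef) : S.C x * S.A x = Er m r := by
  have hd : IsUnit (S.W x).det := (Matrix.isUnit_iff_isUnit_det _).1 hx.isUnit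
  have h0 : (1 - Er m r) * (hatE m r)ᴴ = 0 := by
    rw [Matrix.sub_mul, Er_mul_hatE S.r_le, Matrix.one_mul, sub_self]
  have h1 : hatE m r * ((hatE m r)ᴴ * (S.W x * hatE m r)) = S.W x * hatE m r := by
    rw [← Matrix.mul_assoc, hatE_mul_conjTranspose S.r_le, Matrix.one_mul]
  have h2 : (1 - Er m r) * ((hatE m r)ᴴ * (S.W x * hatE m r)) = 0 := by
    rw [← Matrix.mul_assoc, h0, Matrix.zero_mul]
  rw [C, A, Matrix.add_mul, Matrix.mul_assoc (hatE m r)ᴴ (S.W x), h2, add_zero,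
    Matrix.mul_assoc, h1, Matrix.mul_assoc, Matrix.nonsing_inv_mul_cancel_left _ _ hd, Er]

/-- On the first r coordinates A inverts W⁻¹, and on the others 1 - E_r inverts the identity; mixed
products vanish. -/
lemma inv_mul_C {x : ℝ} (hx : (S.W x).PosDef) : (S.A x + (1 - Er m r)) * S.C x = 1 := by
  have hd : IsUnit (S.W x).det := (Matrix.isUnit_iff_isUnit_det _).1 hx.isUnit
  have h0 : (1 - Er m r) * (hatE m r)ᴴ = 0 := by
    rw [Matrix.sub_mul, Er_mul_hatE S.r_le, Matrix.one_mul, sub_self]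
  have h3 : S.A x * (1 - Er m r) = 0 := by
    rw [Matrix.mul_sub, A_mul_Er, Matrix.mul_one, sub_self]
  have h4 : (1 - Er m r) * (1 - Er m r) = 1 - Er m r := by
    rw [Matrix.mul_sub, Matrix.sub_mul, Matrix.sub_mul, Er_mul_Er S.r_le]
    simp
  have h5 : S.A x * ((hatE m r)ᴴ * ((S.W x)⁻¹ * hatE m r)) = Er m r := by
    rw [A, Matrix.mul_assoc, Matrix.mul_assoc, ← Matrix.mul_assoc (hatE m r) (hatE m r)ᴴ,
      hatE_mul_conjTranspose S.r_le, Matrix.one_mul, Matrix.mul_nonsing_inv_cancel_left _ _ hd, Er]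
  have h6 : (1 - Er m r) * ((hatE m r)ᴴ * ((S.W x)⁻¹ * hatE m r)) = 0 := by
    rw [← Matrix.mul_assoc, h0, Matrix.zero_mul]
  rw [C, Matrix.add_mul, Matrix.mul_add, Matrix.mul_add, Matrix.mul_assoc (hatE m r)ᴴ, h3, h4, h5,
    h6]
  simp

/-- One direction multiplies by C⁻¹ = A + (1 - E_r), where the part 1 - E_r drops out because all
terms lie in the range of E_r; the other uses CA = E_r. -/
lemma tau_eq_iff {x : ℝ} (hx : (S.W x).PosDef) {F : ℝ → CVec m} {z : ℂ} {g : CVec m}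
    (hg : Er m r *ᵥ g = g) :
    S.tau F x - z • (Er m r *ᵥ F x) = g ↔
      Matrix.J (Fin m) ℂ *ᵥ deriv F x = S.B x *ᵥ F x + S.A x *ᵥ (z • F x + g) := by
  constructor
  · intro h
    have h1 : S.tau F x = z • (Er m r *ᵥ F x) + g := by rw [← h, add_sub_cancel]
    have h2 : Matrix.J (Fin m) ℂ *ᵥ deriv F x - S.B x *ᵥ F x =
        (S.A x + (1 - Er m r)) *ᵥ S.tau F x := by
      rw [tau, mulVec_mulVec, S.inv_mul_C hx, one_mulVec]
    rw [← sub_eq_iff_eq_add', h2, h1, add_mulVec, sub_mulVec, one_mulVec, mulVec_add, mulVec_add,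
      mulVec_add, mulVec_smul, mulVec_smul, mulVec_smul, A_mulVec_Er, mulVec_mulVec,
      Er_mul_Er S.r_le, hg]
    simp
  · intro h
    have h2 : Matrix.J (Fin m) ℂ *ᵥ deriv F x - S.B x *ᵥ F x = S.A x *ᵥ (z • F x + g) := by
      rw [h, add_sub_cancel_left]
    rw [tau, h2, mulVec_mulVec, S.C_mul_A hx, mulVec_add, mulVec_smul, hg, add_sub_cancel_left]

lemma ErL2A_Er {c : EReal} (g : S.ErL2A c) :
    ∀ᵐ x ∂volume.restrict (ival a c), Er m r *ᵥ g.1 x = g.1 x := by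
  have h : aeMulVec _ (Er m r) g.1 - g.1 = 0 := g.2.2
  have h2 := sub_eq_zero.1 h
  filter_upwards [aeMulVec_coe _ (Er m r) g.1] with x h1
  rw [← h1, h2]

lemma ErL2A_memL2A {c : EReal} (g : S.ErL2A c) : S.MemL2A (ival a c) g.1 := by
  refine ⟨g.1.aestronglyMeasurable, ?_⟩
  have h : S.normSqW (ival a c) (aeMulVec _ (hatE m r) g.1) < ∞ := g.2.1
  rwa [S.normSqW_congr (aeMulVec_coe _ (hatE m r) g.1)] at h

/-- The class of `E_r k`, for `k` in `L²_A`. -/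
lemma exists_ErL2A {c : EReal} {k : ℝ → CVec m} (hk : S.MemL2A (ival a c) k) :
    ∃ g : S.ErL2A c, g.1 =ᵐ[volume.restrict (ival a c)] fun x => Er m r *ᵥ k x := by
  have hm : AEStronglyMeasurable (fun x => Er m r *ᵥ k x) (volume.restrict (ival a c)) :=
    (continuous_mulVec (Er m r)).comp_aestronglyMeasurable hk.1
  have hcoe := AEEqFun.coeFn_mk _ hm
  refine ⟨⟨AEEqFun.mk _ hm, ?_, ?_⟩, hcoe⟩
  · change S.normSqW _ _ < ∞
    have e : S.normSqW (ival a c) (aeMulVec _ (hatE m r) (AEEqFun.mk _ hm)) =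
        S.normSqA (ival a c) k := by
      refine S.normSqW_congr ?_
      filter_upwards [aeMulVec_coe _ (hatE m r) (AEEqFun.mk _ hm), hcoe] with x h1 h2
      rw [h1, h2, mulVec_mulVec, hatE_mul_Er S.r_le]
    rw [e]
    exact hk.2
  · change aeMulVec _ (Er m r) (AEEqFun.mk _ hm) - AEEqFun.mk _ hm = 0
    rw [sub_eq_zero]
    refine AEEqFun.ext ?_
    filter_upwards [aeMulVec_coe _ (Er m r) (AEEqFun.mk _ hm), hcoe] with x h1 h2
    rw [h1, h2, mulVec_mulVec, Er_mul_Er S.r_le]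

lemma hatOp_coe {c : EReal} (F : S.maxDom c) :
    (S.hatOp c F).1 =ᵐ[volume.restrict (ival a c)] fun x => hatE m r *ᵥ (F : ℝ → CVec m) x := by
  change aeMulVec _ (hatE m r) (S.toClass c F) =ᵐ[_] _
  filter_upwards [aeMulVec_coe _ (hatE m r) (S.toClass c F),
    AEEqFun.coeFn_mk (F : ℝ → CVec m) F.2.2.2.1.1] with x h1 h2
  exact h1.trans (congrArg _ h2)

lemma extE_coe {c : EReal} (f : S.L2W c) :
    (S.extE c f).1 =ᵐ[volume.restrict (ival a c)] fun x => (hatE m r)ᴴ *ᵥ f.1 x :=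
  aeMulVec_coe _ _ _

lemma ErOp_coe {c : EReal} (F : S.maxDom c) :
    (S.ErOp c F).1 =ᵐ[volume.restrict (ival a c)] fun x => Er m r *ᵥ (F : ℝ → CVec m) x := by
  have h := S.extE_coe (S.hatOp c F)
  filter_upwards [h, S.hatOp_coe F] with x h1 h2
  refine h1.trans ?_
  rw [h2, mulVec_mulVec, Er]

/-- The equation `(T - z E_r) F = g` as a differential equation. -/
lemma pencil_eq_iff {c : EReal} {D : Submodule ℂ (S.maxDom c)} {z : ℂ} (F : D) (g : S.ErL2A c) :
    S.pencil D z F = g ↔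
      S.SolvesOn (ival a c) (F : S.maxDom c) (z • ((F : S.maxDom c) : ℝ → CVec m) + g.1) := by
  have hp : (S.pencil D z F).1 =ᵐ[volume.restrict (ival a c)]
      fun x => S.tau (F : S.maxDom c) x - z • (Er m r *ᵥ ((F : S.maxDom c) : ℝ → CVec m) x) := by
    have e1 := AEEqFun.coeFn_sub (S.maxOp c F).1 (z • (S.ErOp c F).1)
    have e2 := AEEqFun.coeFn_smul z (S.ErOp c F).1
    filter_upwards [e1, e2, S.maxOp_coe (F : S.maxDom c), S.ErOp_coe (F : S.maxDom c)]
      with x h1 h2 h3 h4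
    refine h1.trans ?_
    rw [Pi.sub_apply, h2, h3, Pi.smul_apply, h4]
  constructor
  · intro h
    filter_upwards [hp, S.ErL2A_Er g, S.ae_posDef (ival_subset a c)] with x h1 h2 h3
    rw [h] at h1
    exact (S.tau_eq_iff h3 h2).1 h1.symm
  · intro h
    refine S.ErL2A_ext ?_
    filter_upwards [hp, S.ErL2A_Er g, S.ae_posDef (ival_subset a c), h] with x h1 h2 h3 h4
    rw [h1]
    exact (S.tau_eq_iff h3 h2).2 h4

/-- The equation with right-hand side Ak forces τF = E_r k, so τF lies in E_r L²_A. This is how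
solutions are recognized as domain elements. -/
lemma mem_maxDom {c : EReal} {F k : ℝ → CVec m}
    (h0 : ∀ x : ℝ, ¬ (a ≤ x ∧ (x : EReal) ≤ c) → F x = 0)
    (hac : ∀ d : ℝ, a ≤ d → (d : EReal) ≤ c → AbsolutelyContinuousOnInterval F a d)
    (hF : S.MemL2A (ival a c) F) (hk : S.MemL2A (ival a c) k) (h : S.SolvesOn (ival a c) F k) :
    F ∈ S.maxDom c := by
  obtain ⟨g, hg⟩ := S.exists_ErL2A hk
  refine ⟨h0, hac, hF, g, ?_⟩
  filter_upwards [hg, h, S.ae_posDef (ival_subset a c), S.ErL2A_Er g] with x h1 h2 h3 h4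
  have := (S.tau_eq_iff (F := F) (z := 0) h3 h4).2 (by
    rw [h2, h1, zero_smul, zero_add, A_mulVec_Er])
  rwa [zero_smul, sub_zero] at this

lemma SolvesOn.congr {S : HamiltonianSystem m r a} {s : Set ℝ} (hs : MeasurableSet s)
    (hso : IsOpen s) {F G k l : ℝ → CVec m}
    (h : S.SolvesOn s F k) (hFG : EqOn F G s)
    (hkl : ∀ᵐ x ∂volume.restrict s, S.A x *ᵥ k x = S.A x *ᵥ l x) : S.SolvesOn s G l := by
  filter_upwards [h, hkl, ae_restrict_mem hs] with x h1 h2 hx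
  have : F =ᶠ[nhds x] G := Filter.eventuallyEq_of_mem (hso.mem_nhds hx) hFG
  rw [← this.deriv_eq, ← hFG hx, h1, h2]

lemma isOpen_ival (a : ℝ) (c : EReal) : IsOpen (ival a c) :=
  isOpen_Ioi.inter (isOpen_Iio.preimage continuous_coe_real_ereal)

lemma normSqA_congr_set {s : Set ℝ} (hs : MeasurableSet s) {F G : ℝ → CVec m} (h : EqOn F G s) :
    S.normSqA s F = S.normSqA s G :=
  S.normSqA_congr (by filter_upwards [ae_restrict_mem hs] with x hx using h hx)

lemma normSqA_Er (s : Set ℝ) (k : ℝ → CVec m) :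
    S.normSqA s (fun x => Er m r *ᵥ k x) = S.normSqA s k := by
  simp only [normSqA, mulVec_mulVec, hatE_mul_Er S.r_le]

/-- Solvability of the half-line boundary value problem at a point of the resolvent set. -/
lemma exists_solvesOn_half {α : Matrix (Fin m ⊕ Fin m) (Fin m) ℂ} {z : ℂ}
    (h0 : z ∉ S.spectrum (S.domHalf α)) :
    ∃ K : ℝ≥0, ∀ k, S.MemL2A (Ioi a) k → ∃ F : ℝ → CVec m,
      (∀ d, a ≤ d → AbsolutelyContinuousOnInterval F a d) ∧
      αᴴ *ᵥ (Matrix.J (Fin m) ℂ *ᵥ F a) = 0 ∧ S.MemL2A (Ioi a) F ∧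
      S.SolvesOn (Ioi a) F (z • F + k) ∧
      S.normSqA (Ioi a) F ≤ K * S.normSqA (Ioi a) k := by
  obtain ⟨hb, K, hK⟩ := not_not.1 h0
  refine ⟨K, fun k hk => ?_⟩
  rw [← ival_top] at hk ⊢
  obtain ⟨g, hg⟩ := S.exists_ErL2A hk
  obtain ⟨F, hF⟩ := hb.2 g
  refine ⟨(F : S.maxDom ⊤), fun d hd => F.1.2.2.1 d hd le_top, F.2, F.1.2.2.2.1, ?_, ?_⟩
  · refine ((S.pencil_eq_iff F g).1 hF).congr (measurableSet_ival _ _) (isOpen_ival _ _)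
      (fun _ _ => rfl) ?_
    filter_upwards [hg] with x hx
    rw [Pi.add_apply, Pi.add_apply, hx, mulVec_add, A_mulVec_Er, mulVec_add]
  · have := hK F
    rwa [hF, S.normSqA_congr hg, normSqA_Er] at this

/-- Extended by zero to the left of a, such a solution lies in the kernel of T_a - zE_r, which is
injective. -/
lemma eq_zero_of_isSolution_half {α : Matrix (Fin m ⊕ Fin m) (Fin m) ℂ} {z : ℂ}
    (h0 : z ∉ S.spectrum (S.domHalf α)) {F : ℝ → CVec m} (hF : S.IsSolution z F)
    (hbc : αᴴ *ᵥ (Matrix.J (Fin m) ℂ *ᵥ F a) = 0) (hL : S.MemL2A (Ioi a) F)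
    {x : ℝ} (hx : a ≤ x) : F x = 0 := by
  obtain ⟨hb, -⟩ := not_not.1 h0
  have hEq : EqOn F ((Ici a).indicator F) (Ioi a) := fun y hy =>
    (indicator_of_mem (mem_Ici.2 (le_of_lt hy)) F).symm
  have hs : S.SolvesOn (ival a ⊤) ((Ici a).indicator F) (z • F) := by
    rw [ival_top]
    exact hF.solvesOn.congr measurableSet_Ioi isOpen_Ioi hEq (.of_forall fun _ => rfl)
  have hL' : S.MemL2A (ival a ⊤) ((Ici a).indicator F) := by
    rw [ival_top]
    exact hL.congr (by filter_upwards [ae_restrict_mem measurableSet_Ioi] with y hy using hEq hy)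
  have hmem : (Ici a).indicator F ∈ S.maxDom ⊤ := by
    refine S.mem_maxDom (fun y hy => ?_) (fun d hd _ => ?_) hL' (k := z • F) ?_ hs
    · exact indicator_of_notMem (fun h => hy ⟨h, le_top⟩) F
    · refine (hF.1 d hd).congr fun y hy => ?_
      rw [uIcc_of_le hd] at hy
      exact (indicator_of_mem (mem_Ici.2 hy.1) F).symm
    · rw [ival_top]
      exact hL.smul z
  have hbc' : (⟨_, hmem⟩ : S.maxDom ⊤) ∈ S.domHalf α := by
    change αᴴ *ᵥ (Matrix.J (Fin m) ℂ *ᵥ (Ici a).indicator F a) = 0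
    rwa [indicator_of_mem (mem_Ici.2 le_rfl)]
  have hker : S.pencil (S.domHalf α) z ⟨⟨_, hmem⟩, hbc'⟩ = 0 := by
    rw [S.pencil_eq_iff]
    refine hs.congr (measurableSet_ival _ _) (isOpen_ival _ _) (fun _ _ => rfl) ?_
    filter_upwards [AEEqFun.coeFn_zero (μ := volume.restrict (ival a ⊤)) (β := CVec m),
      ae_restrict_mem (measurableSet_ival a ⊤)] with y hy hya
    rw [ival_top] at hya
    have e : (((0 : S.ErL2A ⊤).1) : ℝ → CVec m) y = 0 := hy
    rw [Pi.add_apply, e, add_zero, Pi.smul_apply, Pi.smul_apply]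
    change _ = S.A y *ᵥ (z • (Ici a).indicator F y)
    rw [← hEq hya]
  have h1 := hb.1 (hker.trans (map_zero _).symm)
  have h2 := congrFun (congrArg (fun G : S.domHalf α => ((G : S.maxDom ⊤) : ℝ → CVec m)) h1) x
  rw [← indicator_of_mem (mem_Ici.2 hx) F]
  exact h2

end HamiltonianSystem

/-! ### Boundary condition matrices -/

section Boundary

variable {m : ℕ} {α : Matrix (Fin m ⊕ Fin m) (Fin m) ℂ}

lemma IsBoundaryMatrix.conjTranspose_mul_self (hα : IsBoundaryMatrix α) : αᴴ * α = 1 := by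
  have h := Matrix.mem_unitaryGroup_iff'.1 hα
  rw [star_eq_conjTranspose, conjTranspose_fromCols_eq_fromRows_conjTranspose,
    fromRows_mul_fromCols, ← fromBlocks_one, fromBlocks_inj] at h
  exact h.1

lemma IsBoundaryMatrix.mul_J_mul_self (hα : IsBoundaryMatrix α) :
    αᴴ * (Matrix.J (Fin m) ℂ * α) = 0 := by
  have h := Matrix.mem_unitaryGroup_iff'.1 hα
  rw [star_eq_conjTranspose, conjTranspose_fromCols_eq_fromRows_conjTranspose,
    fromRows_mul_fromCols, ← fromBlocks_one, fromBlocks_inj] at h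
  exact h.2.1

lemma IsBoundaryMatrix.mulVec_eq_zero (hα : IsBoundaryMatrix α) {w : Fin m → ℂ}
    (h : α *ᵥ w = 0) : w = 0 := by
  rw [← one_mulVec w, ← hα.conjTranspose_mul_self, ← mulVec_mulVec, h, mulVec_zero]

/-- Unitarity gives αα* + Jα(Jα)* = 1, and the boundary condition kills the second term applied to
u. -/
lemma IsBoundaryMatrix.eq_mulVec (hα : IsBoundaryMatrix α) {u : CVec m}
    (h : αᴴ *ᵥ (Matrix.J (Fin m) ℂ *ᵥ u) = 0) : u = α *ᵥ (αᴴ *ᵥ u) := by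
  have h1 := Matrix.mem_unitaryGroup_iff.1 hα
  rw [star_eq_conjTranspose, conjTranspose_fromCols_eq_fromRows_conjTranspose,
    fromCols_mul_fromRows, conjTranspose_mul, conjTranspose_J] at h1
  have h2 := congrArg (fun M => M *ᵥ u) h1
  simp only [add_mulVec, one_mulVec, ← mulVec_mulVec, neg_mulVec, mulVec_neg, h, mulVec_zero,
    neg_zero, add_zero] at h2
  exact h2.symm

lemma IsBoundaryMatrix.bc_mulVec (hα : IsBoundaryMatrix α) (w : Fin m → ℂ) :
    αᴴ *ᵥ (Matrix.J (Fin m) ℂ *ᵥ (α *ᵥ w)) = 0 := by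
  rw [mulVec_mulVec, mulVec_mulVec, Matrix.mul_assoc, hα.mul_J_mul_self, zero_mulVec]

/-- Vectors satisfying the condition lie in ran α, which is isotropic. Hence the boundary term at a
in Lagrange's identity drops out. -/
lemma IsBoundaryMatrix.jform_eq_zero (hα : IsBoundaryMatrix α) {u v : CVec m}
    (hu : αᴴ *ᵥ (Matrix.J (Fin m) ℂ *ᵥ u) = 0) (hv : αᴴ *ᵥ (Matrix.J (Fin m) ℂ *ᵥ v) = 0) :
    jform u v = 0 := by
  rw [hα.eq_mulVec hu, jform, star_mulVec_dotProduct, hv, dotProduct_zero]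

end Boundary

/-! ### Square-integrable solutions and the half-line problem -/

namespace HamiltonianSystem

variable {m r : ℕ} {a : ℝ} (S : HamiltonianSystem m r a)

lemma MemL2A.union {S : HamiltonianSystem m r a} {s t : Set ℝ} {F : ℝ → CVec m}
    (h1 : S.MemL2A s F) (h2 : S.MemL2A t F) : S.MemL2A (s ∪ t) F :=
  ⟨aestronglyMeasurable_union_iff.2 ⟨h1.1, h2.1⟩,
    (lintegral_union_le _ _ _).trans_lt (ENNReal.add_lt_top.2 ⟨h1.2, h2.2⟩)⟩

lemma memL2A_mulVec {s : Set ℝ} (hs : s ⊆ Ioi a) {ι : Type} [Fintype ι]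
    {Ψ : ℝ → Matrix (Fin m ⊕ Fin m) ι ℂ}
    (h : ∀ j, S.MemL2A s fun x i => Ψ x i j) (v : ι → ℂ) :
    S.MemL2A s fun x => Ψ x *ᵥ v := by
  classical
  have : ∀ t : Finset ι, S.MemL2A s fun x i => ∑ j ∈ t, Ψ x i j * v j := by
    intro t
    induction t using Finset.induction_on with
    | empty =>
      simp only [Finset.sum_empty]
      exact S.memL2A_zero s
    | insert j t hj ih =>
      simp only [Finset.sum_insert hj]
      have h2 := ((h j).smul (v j)).add hs ih
      convert h2 using 3
      simp [mul_comm]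
  exact this Finset.univ

lemma IsSolution.continuousOn {S : HamiltonianSystem m r a} {z : ℂ} {F : ℝ → CVec m}
    (hF : S.IsSolution z F) {p q : ℝ} (hp : a ≤ p) : ContinuousOn F (Icc p q) := by
  rcases le_or_gt p q with h | h
  · have := (hF.ac hp h).continuousOn
    rwa [uIcc_of_le h] at this
  · rw [Icc_eq_empty (not_le.2 h)]
    exact continuousOn_empty _

lemma IsSolution.memL2A {S : HamiltonianSystem m r a} {z : ℂ} {F : ℝ → CVec m}
    (hF : S.IsSolution z F) (q : ℝ) : S.MemL2A (Ioo a q) F :=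
  S.memL2A_of_continuousOn le_rfl (hF.continuousOn le_rfl)

lemma IsSolution.memL2A_of_tail {S : HamiltonianSystem m r a} {z : ℂ} {F : ℝ → CVec m}
    (hF : S.IsSolution z F) {c : ℝ} (h : S.MemL2A (Ioi c) F) : S.MemL2A (Ioi a) F := by
  refine ((hF.memL2A (c + 1)).union h).mono fun x hx => ?_
  rcases lt_or_ge c x with h1 | h1
  · exact Or.inr h1
  · exact Or.inl ⟨hx, by linarith⟩

/-- The definiteness condition on an initial interval. -/
lemma Definite.normSqA_pos {S : HamiltonianSystem m r a} (hdef : S.Definite) {z : ℂ}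
    {F : ℝ → CVec m} (hF : S.IsSolution z F) (h : F a ≠ 0) {d : ℝ} (hd : a < d) :
    0 < S.normSqA (Ioo a d) F := by
  -- Definiteness is stated for compact intervals to the right of a, so one is chosen inside (a, d).
  refine (hdef z F hF ⟨a, le_rfl, h⟩ (a + (d - a) / 3) (a + (d - a) / 2) (by linarith)
    (by linarith)).trans_le (lintegral_mono_set fun x hx => ⟨?_, ?_⟩)
  · linarith [hx.1]
  · linarith [hx.2]

section WeylPlus

variable {S} {α : Matrix (Fin m ⊕ Fin m) (Fin m) ℂ} {l x₀ : ℝ}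
  {Ψ : ℝ → Matrix (Fin m ⊕ Fin m) (Fin m) ℂ}

lemma IsMatSolution.mulVec {z : ℂ} (h : S.IsMatSolution z Ψ) (v : Fin m → ℂ) :
    S.IsSolution z fun x => Ψ x *ᵥ v := S.isSolution_mulVec h v

/-- A normalized matrix solution has full rank at every point. -/
lemma IsMatSolution.mulVec_eq_zero (h : S.IsMatSolution l Ψ) (hn : IsNormalizedAt x₀ Ψ)
    (hx₀ : a ≤ x₀) {x : ℝ} (hx : a ≤ x) {v : Fin m → ℂ} (hv : Ψ x *ᵥ v = 0) : v = 0 := by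
  have h1 := (h.mulVec v).eqOn (S.isSolution_zero l) hx hv hx₀
  obtain ⟨M, hM⟩ := hn
  rw [hM, fromRows_mulVec, one_mulVec] at h1
  funext i
  exact congrFun h1 (Sum.inl i)

lemma IsWeylPlus.memL2A (h : S.IsWeylPlus l x₀ Ψ) (v : Fin m → ℂ) :
    S.MemL2A (Ioi a) fun x => Ψ x *ᵥ v :=
  (h.1.mulVec v).memL2A_of_tail (c := a + 1)
    (S.memL2A_mulVec (Ioi_subset_Ioi (by linarith)) (h.2.1 (a + 1) (by linarith)) v)

/-- A solution satisfying the condition at a cannot also be square integrable unless it is zero, as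
λ₀ is not an eigenvalue of T_a. -/
lemma eq_zero_of_memL2A_fund (hα : IsBoundaryMatrix α)
    (h0 : (l : ℂ) ∉ S.spectrum (S.domHalf α)) {w : Fin m → ℂ}
    (h : S.MemL2A (Ioi a) fun x => S.fund l x *ᵥ (α *ᵥ w)) : w = 0 := by
  have h1 := S.eq_zero_of_isSolution_half h0 (S.isSolution_fund l (α *ᵥ w))
    (by rw [fund_self, one_mulVec]; exact hα.bc_mulVec w) h (le_refl a)
  rw [fund_self, one_mulVec] at h1
  exact hα.mulVec_eq_zero h1

/-- At a point of the resolvent set every solution in `L²_A` near `∞` is a combination of the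
columns of the Weyl–Titchmarsh solution. -/
lemma IsWeylPlus.exists_eq_mulVec (hΨ : S.IsWeylPlus l x₀ Ψ)
    (hα : IsBoundaryMatrix α) (hx₀ : a ≤ x₀)
    (h0 : (l : ℂ) ∉ S.spectrum (S.domHalf α)) {F : ℝ → CVec m}
    (hF : S.IsSolution l F) (hL : S.MemL2A (Ioi a) F) : ∃ v, ∀ x, a ≤ x → F x = Ψ x *ᵥ v := by
  -- Here G - Ψu is square integrable and starts at αw, so w = 0. With G = 0 this shows that the 2m
  -- columns of Ψ(a) and α form a basis; applied to F it removes the α-component.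
  have key : ∀ (G : ℝ → CVec m), S.IsSolution l G → S.MemL2A (Ioi a) G → ∀ u w : Fin m → ℂ,
      G a = Ψ a *ᵥ u + α *ᵥ w → w = 0 := by
    intro G hG hGL u w h
    refine eq_zero_of_memL2A_fund hα h0 ?_
    have h1 : S.MemL2A (Ioi a) (G + (-1 : ℂ) • fun x => Ψ x *ᵥ u) :=
      hGL.add Subset.rfl ((hΨ.memL2A u).smul _)
    have h2 : S.IsSolution l (G + (-1 : ℂ) • fun x => Ψ x *ᵥ u) :=
      hG.add ((hΨ.1.mulVec u).smul _)
    refine h1.congr ?_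
    filter_upwards [ae_restrict_mem measurableSet_Ioi] with x hx
    refine h2.eqOn (S.isSolution_fund l _) le_rfl ?_ (le_of_lt hx)
    simp [h, fund_self]
  have hQ : IsUnit (fromCols (Ψ a) α) := by
    refine isUnit_of_mulVec_eq_zero fun v hv => ?_
    rw [fromCols_mulVec] at hv
    have hw := key 0 (S.isSolution_zero l) (S.memL2A_zero _) _ _ hv.symm
    rw [hw, mulVec_zero, add_zero] at hv
    have hu := hΨ.1.mulVec_eq_zero hΨ.2.2 hx₀ le_rfl hv
    funext i
    rcases i with i | i
    · exact congrFun hu i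
    · exact congrFun hw i
  obtain ⟨v, hv⟩ := (Matrix.mulVec_surjective_iff_isUnit.2 hQ) (F a)
  rw [fromCols_mulVec] at hv
  have hw := key F hF hL _ _ hv.symm
  rw [hw, mulVec_zero, add_zero] at hv
  exact ⟨_, fun x hx => hF.eqOn (hΨ.1.mulVec _) le_rfl hv.symm hx⟩

/-- Since U(d) is invertible, the solution on (d, ∞) continues back to a; continuity near a keeps it
square integrable. -/
lemma IsWeylPlus.exists_eq_mulVec_of_tail (hΨ : S.IsWeylPlus l x₀ Ψ)
    (hα : IsBoundaryMatrix α) (hx₀ : a ≤ x₀)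
    (h0 : (l : ℂ) ∉ S.spectrum (S.domHalf α)) {d : ℝ} (hd : a ≤ d)
    {F : ℝ → CVec m} (hac : ∀ D, d ≤ D → AbsolutelyContinuousOnInterval F d D)
    (hs : S.SolvesOn (Ioi d) F ((l : ℂ) • F)) (hL : S.MemL2A (Ioi d) F) :
    ∃ v, ∀ x, d ≤ x → F x = Ψ x *ᵥ v := by
  obtain ⟨u, hu⟩ := S.exists_fund_mulVec l hd (F d)
  have hU := S.isSolution_fund l u
  have heq : ∀ x, d ≤ x → S.fund l x *ᵥ u = F x := fun x hx =>
    S.eq_of_solvesOn hd (hU.ac hd hx) (hU.solvesOn.mono fun y hy => hd.trans_lt hy.1)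
      (hac x hx) (hs.mono Ioo_subset_Ioi_self) ⟨le_rfl, hx⟩ hu ⟨hx, le_rfl⟩
  have hUL : S.MemL2A (Ioi a) fun x => S.fund l x *ᵥ u := by
    refine hU.memL2A_of_tail (c := d) (hL.congr ?_)
    filter_upwards [ae_restrict_mem measurableSet_Ioi] with x hx using (heq x (le_of_lt hx)).symm
  obtain ⟨v, hv⟩ := hΨ.exists_eq_mulVec hα hx₀ h0 hU hUL
  exact ⟨v, fun x hx => by rw [← heq x hx, hv x (hd.trans hx)]⟩

/-- Solutions of the half-line problem whose right-hand side is supported in `(a, d)`. -/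
lemma IsWeylPlus.exists_solvesOn_compact (hΨ : S.IsWeylPlus l x₀ Ψ)
    (hα : IsBoundaryMatrix α) (hx₀ : a ≤ x₀)
    (h0 : (l : ℂ) ∉ S.spectrum (S.domHalf α)) :
    ∃ K : ℝ≥0, ∀ d, a ≤ d → ∀ k, S.MemL2A (Ioo a d) k → ∃ (F : ℝ → CVec m) (v : Fin m → ℂ),
      (∀ D, a ≤ D → AbsolutelyContinuousOnInterval F a D) ∧
      αᴴ *ᵥ (Matrix.J (Fin m) ℂ *ᵥ F a) = 0 ∧ S.MemL2A (Ioi a) F ∧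
      S.SolvesOn (Ioo a d) F ((l : ℂ) • F + k) ∧ S.SolvesOn (Ioi d) F ((l : ℂ) • F) ∧
      (∀ x, d ≤ x → F x = Ψ x *ᵥ v) ∧
      S.normSqA (Ioi a) F ≤ K * S.normSqA (Ioo a d) k := by
  obtain ⟨K, hK⟩ := S.exists_solvesOn_half h0
  refine ⟨K, fun d hd k hk => ?_⟩
  -- Extending by zero preserves the norm, so the resolvent constant K serves all d simultaneously.
  -- Beyond d the equation is homogeneous, which forces the form Ψv there.
  set k' := (Ioo a d).indicator k with hk'
  have hn : S.normSqA (Ioi a) k' = S.normSqA (Ioo a d) k := by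
    have : ∀ x, ENNReal.ofReal (S.aform x (k' x) (k' x)).re =
        (Ioo a d).indicator (fun x => ENNReal.ofReal (S.aform x (k x) (k x)).re) x := by
      intro x
      by_cases hx : x ∈ Ioo a d
      · rw [hk', indicator_of_mem hx, indicator_of_mem hx]
      · rw [hk', indicator_of_notMem hx, indicator_of_notMem hx]
        simp [aform]
    rw [normSqA_eq, normSqA_eq, lintegral_congr this, lintegral_indicator measurableSet_Ioo,
      Measure.restrict_restrict measurableSet_Ioo, inter_eq_left.2 Ioo_subset_Ioi_self]
  have hk'm : S.MemL2A (Ioi a) k' := by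
    refine ⟨?_, by rw [hn]; exact hk.2⟩
    exact ((aestronglyMeasurable_indicator_iff measurableSet_Ioo).2 hk.1).mono_measure
      Measure.restrict_le_self
  obtain ⟨F, hac, hbc, hL, hs, hle⟩ := hK k' hk'm
  have hs2 : S.SolvesOn (Ioi d) F ((l : ℂ) • F) := by
    refine (hs.mono (Ioi_subset_Ioi hd)).congr measurableSet_Ioi isOpen_Ioi (fun _ _ => rfl) ?_
    filter_upwards [ae_restrict_mem measurableSet_Ioi] with x hx
    rw [Pi.add_apply, hk', indicator_of_notMem (fun h => lt_asymm h.2 hx), add_zero]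
  have hs1 : S.SolvesOn (Ioo a d) F ((l : ℂ) • F + k) := by
    refine (hs.mono Ioo_subset_Ioi_self).congr measurableSet_Ioo isOpen_Ioo (fun _ _ => rfl) ?_
    filter_upwards [ae_restrict_mem measurableSet_Ioo] with x hx
    rw [Pi.add_apply, Pi.add_apply, hk', indicator_of_mem hx]
  obtain ⟨v, hv⟩ := hΨ.exists_eq_mulVec_of_tail hα hx₀ h0 hd (F := F) (fun D hD =>
    (hac D (hd.trans hD)).mono (by
      rw [uIcc_of_le hD, uIcc_of_le (hd.trans hD)]; exact Icc_subset_Icc_left hd))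
    hs2 (hL.mono (Ioi_subset_Ioi hd))
  exact ⟨F, v, hac, hbc, hL, hs1, hs2, hv, by rw [← hn]; exact hle⟩

end WeylPlus

end HamiltonianSystem

/-! ### Isotropy of the Weyl–Titchmarsh solution -/

lemma jform_mulVec {m : ℕ} {ι κ : Type*} [Fintype ι] [Fintype κ]
    (P : Matrix (Fin m ⊕ Fin m) ι ℂ) (Q : Matrix (Fin m ⊕ Fin m) κ ℂ) (u : ι → ℂ) (v : κ → ℂ) :
    jform (P *ᵥ u) (Q *ᵥ v) = star u ⬝ᵥ ((Pᴴ * Matrix.J (Fin m) ℂ * Q) *ᵥ v) := by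
  rw [jform, star_mulVec_dotProduct, mulVec_mulVec, mulVec_mulVec, Matrix.mul_assoc]

namespace HamiltonianSystem

variable {m r : ℕ} {a : ℝ} {S : HamiltonianSystem m r a}
  {α : Matrix (Fin m ⊕ Fin m) (Fin m) ℂ} {l x₀ : ℝ}
  {Ψ : ℝ → Matrix (Fin m ⊕ Fin m) (Fin m) ℂ}

lemma IsSolution.jform_eq {F G : ℝ → CVec m} (hF : S.IsSolution l F) (hG : S.IsSolution l G)
    {x : ℝ} (hx : a ≤ x) : jform (F x) (G x) = jform (F a) (G a) :=
  S.jform_const le_rfl hx (hF.ac le_rfl hx) (hG.ac le_rfl hx)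
    (hF.solvesOn.mono Ioo_subset_Ioi_self) (hG.solvesOn.mono Ioo_subset_Ioi_self)

/-- Lagrange's identity for two inhomogeneous equations with the same real spectral parameter. -/
lemma jform_eq_add_integral_of_real {p q : ℝ} (hp : a ≤ p) (hpq : p ≤ q) {F G f g : ℝ → CVec m}
    (hF : AbsolutelyContinuousOnInterval F p q) (hG : AbsolutelyContinuousOnInterval G p q)
    (hFf : S.SolvesOn (Ioo p q) F ((l : ℂ) • F + f))
    (hGg : S.SolvesOn (Ioo p q) G ((l : ℂ) • G + g))
    (hf : S.MemL2A (Ioo p q) f) (hg : S.MemL2A (Ioo p q) g) :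
    jform (F q) (G q) = jform (F p) (G p) +
      (∫ x in Ioo p q, S.aform x (F x) (g x)) - ∫ x in Ioo p q, S.aform x (f x) (G x) := by
  have hs : Ioo p q ⊆ Ioi a := fun x hx => hp.trans_lt hx.1
  have mF : S.MemL2A (Ioo p q) F := S.memL2A_of_continuousOn hp (by
    have := hF.continuousOn; rwa [uIcc_of_le hpq] at this)
  have mG : S.MemL2A (Ioo p q) G := S.memL2A_of_continuousOn hp (by
    have := hG.continuousOn; rwa [uIcc_of_le hpq] at this)
  have i0 := S.integrableOn_aform hs mF mG
  have e1 : ∀ x, S.aform x (F x) (((l : ℂ) • G + g) x) =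
      (l : ℂ) * S.aform x (F x) (G x) + S.aform x (F x) (g x) := fun x => by
    rw [Pi.add_apply, Pi.smul_apply, aform, mulVec_add, dotProduct_add, mulVec_smul,
      dotProduct_smul]
    rfl
  have e2 : ∀ x, S.aform x (((l : ℂ) • F + f) x) (G x) =
      (l : ℂ) * S.aform x (F x) (G x) + S.aform x (f x) (G x) := fun x => by
    rw [Pi.add_apply, Pi.smul_apply, aform, star_add, add_dotProduct, star_smul, smul_dotProduct,
      Complex.star_def, Complex.conj_ofReal]
    rfl
  rw [S.jform_eq_add_integral hp hpq hF hG hFf hGg ((mF.smul _).add hs hf)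
    ((mG.smul _).add hs hg)]
  simp only [e1, e2]
  rw [integral_add (i0.const_mul _) (S.integrableOn_aform hs mF hg),
    integral_add (i0.const_mul _) (S.integrableOn_aform hs hf mG)]
  ring

/-- Monotone convergence along the exhaustion of (a, ∞) by the intervals (a, d₀ + n). -/
lemma memL2A_of_bounded {F : ℝ → CVec m} (hm : AEStronglyMeasurable F (volume.restrict (Ioi a)))
    {d₀ C : ℝ} (hF : ∀ d, S.MemL2A (Ioo a d) F)
    (h : ∀ d, d₀ ≤ d → (S.normSqA (Ioo a d) F).toReal ≤ C) : S.MemL2A (Ioi a) F := by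
  refine ⟨hm, ?_⟩
  have hU : Ioi a = ⋃ n : ℕ, Ioo a (d₀ + n) := by
    ext x
    simp only [mem_Ioi, mem_iUnion, mem_Ioo]
    refine ⟨fun hx => ?_, fun ⟨_, h⟩ => h.1⟩
    obtain ⟨n, hn⟩ := exists_nat_gt (x - d₀)
    exact ⟨n, hx, by linarith⟩
  have hmono : Monotone fun n : ℕ => Ioo a (d₀ + n) := fun i j hij =>
    Ioo_subset_Ioo_right (by gcongr)
  rw [normSqA_eq, hU, setLIntegral_iUnion_of_directed _ hmono.directed_le]
  refine (iSup_le fun n => ?_).trans_lt (ENNReal.ofReal_lt_top (r := C))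
  rw [← normSqA_eq, ENNReal.le_ofReal_iff_toReal_le (hF _).2.ne
    (ENNReal.toReal_nonneg.trans (h (d₀ + n) (by simp)))]
  exact h _ (by simp)

lemma integral_aform_self {s : Set ℝ} (hs : s ⊆ Ioi a) {F : ℝ → CVec m} (hF : S.MemL2A s F) :
    (∫ x in s, S.aform x (F x) (F x)).re = (S.normSqA s F).toReal := by
  rw [← S.integral_aform_re hs hF]
  exact (integral_re (S.integrableOn_aform hs hF hF)).symm

/-- At a point of the resolvent set the Weyl–Titchmarsh solution is isotropic. -/
theorem IsWeylPlus.jform_eq_zero (hdef : S.Definite) (hΨ : S.IsWeylPlus l x₀ Ψ)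
    (hα : IsBoundaryMatrix α) (hx₀ : a ≤ x₀) (h0 : (l : ℂ) ∉ S.spectrum (S.domHalf α))
    {x : ℝ} (hx : a ≤ x) : (Ψ x)ᴴ * Matrix.J (Fin m) ℂ * Ψ x = 0 := by
  set φ : (Fin m → ℂ) → ℝ → CVec m := fun w x => S.fund l x *ᵥ (α *ᵥ w) with hφ
  have hφs : ∀ w, S.IsSolution l (φ w) := fun w => S.isSolution_fund l _
  have hφa : ∀ w, φ w a = α *ᵥ w := fun w => by simp only [hφ, fund_self, one_mulVec]
  have hφL : ∀ w d, S.MemL2A (Ioo a d) (φ w) := fun w d => (hφs w).memL2A d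
  have hφbc : ∀ w, αᴴ *ᵥ (Matrix.J (Fin m) ℂ *ᵥ φ w a) = 0 := fun w => by
    rw [hφa]; exact hα.bc_mulVec w
  set K := αᴴ * Matrix.J (Fin m) ℂ * Ψ a with hK
  have hKφ : ∀ w v x, a ≤ x → jform (φ w x) (Ψ x *ᵥ v) = star w ⬝ᵥ (K *ᵥ v) := fun w v x hx => by
    rw [(hφs w).jform_eq (hΨ.1.mulVec v) hx, hφa, jform_mulVec]
  -- If Kv = 0, then Ψv satisfies the boundary condition at a and is square integrable, so it
  -- vanishes.
  have hK0 : ∀ v, K *ᵥ v = 0 → v = 0 := fun v hv => by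
    rw [hK, ← mulVec_mulVec, ← mulVec_mulVec] at hv
    exact hΨ.1.mulVec_eq_zero hΨ.2.2 hx₀ le_rfl
      (S.eq_zero_of_isSolution_half h0 (hΨ.1.mulVec v) hv (hΨ.memL2A v) le_rfl)
  have hKu : IsUnit K := isUnit_of_mulVec_eq_zero hK0
  obtain ⟨C, hC⟩ := hΨ.exists_solvesOn_compact hα hx₀ h0
  -- the Lagrange identity of `φ η` and the solution with right-hand side `φ ξ`
  have hpair : ∀ {d : ℝ} (_ : a ≤ d) {F k : ℝ → CVec m} {v : Fin m → ℂ}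
      (_ : AbsolutelyContinuousOnInterval F a d)
      (_ : αᴴ *ᵥ (Matrix.J (Fin m) ℂ *ᵥ F a) = 0) (_ : S.MemL2A (Ioo a d) k)
      (_ : S.SolvesOn (Ioo a d) F ((l : ℂ) • F + k)) (_ : F d = Ψ d *ᵥ v) (η : Fin m → ℂ),
      star η ⬝ᵥ (K *ᵥ v) = ∫ x in Ioo a d, S.aform x (φ η x) (k x) := by
    intro d hd F k v hac hbc hk hs hv η
    have h := jform_eq_add_integral_of_real le_rfl hd (f := 0) ((hφs η).ac le_rfl hd) hac
      (by rw [add_zero]; exact (hφs η).solvesOn.mono Ioo_subset_Ioi_self) hs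
      (S.memL2A_zero _) hk
    rw [hα.jform_eq_zero (hφbc η) hbc, zero_add] at h
    rw [← hKφ η v d hd, ← hv, h]
    simp [aform]
  -- Taking η = ξ makes the norm of φ ξ on (a, a + 1) zero, which definiteness forbids for ξ ≠ 0.
  have hinj : ∀ ξ v, (∀ η, star η ⬝ᵥ (K *ᵥ v) =
      ∫ x in Ioo a (a + 1), S.aform x (φ η x) (φ ξ x)) → K *ᵥ v = 0 → ξ = 0 := by
    intro ξ v h hv
    by_contra hξ
    have h1 := hdef.normSqA_pos (hφs ξ) (d := a + 1)
      (fun h => hξ (hα.mulVec_eq_zero (by rw [← hφa, h]))) (by linarith)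
    have h2 := h ξ
    rw [hv, dotProduct_zero] at h2
    have h3 := S.integral_aform_self Ioo_subset_Ioi_self (hφL ξ (a + 1))
    rw [← h2, Complex.zero_re] at h3
    exact (ENNReal.toReal_pos h1.ne' (hφL ξ (a + 1)).2.ne).ne h3
  -- every combination of the columns of `Ψ` is attained near `∞` by a solution of the
  -- half-line problem with right-hand side of the form `φ ξ`
  have hsurj : ∀ v₀, ∃ ξ, ∀ v, (∀ η, star η ⬝ᵥ (K *ᵥ v) =
      ∫ x in Ioo a (a + 1), S.aform x (φ η x) (φ ξ x)) → v = v₀ := by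
    intro v₀
    have hint : ∀ η ξ, IntegrableOn (fun x => S.aform x (φ η x) (φ ξ x)) (Ioo a (a + 1)) :=
      fun η ξ => S.integrableOn_aform Ioo_subset_Ioi_self (hφL η _) (hφL ξ _)
    -- `L` is the Gram matrix of the columns of φ on (a, a + 1); being injective on a
    -- finite-dimensional space, it is onto.
    let L : (Fin m → ℂ) →ₗ[ℂ] (Fin m → ℂ) :=
      { toFun := fun ξ i => ∫ x in Ioo a (a + 1), S.aform x (φ (Pi.single i 1) x) (φ ξ x)
        map_add' := fun ξ ζ => by
          funext i
          rw [Pi.add_apply, ← integral_add (hint _ _) (hint _ _)]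
          simp only [hφ, mulVec_add, aform, dotProduct_add]
        map_smul' := fun t ξ => by
          funext i
          simp only [Pi.smul_apply, smul_eq_mul, RingHom.id_apply]
          rw [← integral_const_mul]
          simp only [hφ, mulVec_smul, aform_smul_right] }
    have hL : ∀ ξ v, (∀ η, star η ⬝ᵥ (K *ᵥ v) =
        ∫ x in Ioo a (a + 1), S.aform x (φ η x) (φ ξ x)) → K *ᵥ v = L ξ := by
      intro ξ v h
      funext i
      have := h (Pi.single i 1)
      rwa [← Pi.single_star, star_one, single_one_dotProduct] at this
    have hLinj : Function.Injective L := by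
      rw [← LinearMap.ker_eq_bot, LinearMap.ker_eq_bot']
      intro ξ hξ
      obtain ⟨F, v, hac, hbc, hFL, hs, -, hv, -⟩ := hC (a + 1) (by linarith) (φ ξ) (hφL ξ _)
      have h := hpair (by linarith) (hac _ (by linarith)) hbc
        (hφL ξ _) hs (hv _ le_rfl)
      exact hinj ξ v h (by rw [hL ξ v h, hξ])
    obtain ⟨ξ, hξ⟩ := LinearMap.injective_iff_surjective.1 hLinj (K *ᵥ v₀)
    refine ⟨ξ, fun v h => ?_⟩
    rw [← sub_eq_zero]
    refine hK0 _ ?_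
    rw [mulVec_sub, hL ξ v h, hξ, sub_self]
  set R := (Ψ a)ᴴ * Matrix.J (Fin m) ℂ * Ψ a with hR
  have hΨR : ∀ u v x, a ≤ x → jform (Ψ x *ᵥ u) (Ψ x *ᵥ v) = star u ⬝ᵥ (R *ᵥ v) := fun u v x hx => by
    rw [(hΨ.1.mulVec u).jform_eq (hΨ.1.mulVec v) hx, jform_mulVec]
  have hR0 : ∀ v₀, (R * K⁻¹)ᴴ *ᵥ v₀ = 0 := by
    intro v₀
    -- Chosen so that w*Kv = v₀*Rv: the pairing of Ψv₀ with Ψv is represented by φ w.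
    set w := (R * K⁻¹)ᴴ *ᵥ v₀ with hw
    have hwK : ∀ v, star w ⬝ᵥ (K *ᵥ v) = star v₀ ⬝ᵥ (R *ᵥ v) := fun v => by
      rw [hw, star_mulVec_dotProduct, conjTranspose_conjTranspose, mulVec_mulVec,
        Matrix.nonsing_inv_mul_cancel_right _ _ ((Matrix.isUnit_iff_isUnit_det _).1 hKu)]
    obtain ⟨ξ, hξ⟩ := hsurj v₀
    obtain ⟨F, v, hFac, hFbc, hFL, hFs, hFs', hFv, -⟩ := hC (a + 1) (by linarith) (φ ξ) (hφL ξ _)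
    obtain rfl : v = v₀ := hξ v (hpair (by linarith) (hFac _ (by linarith)) hFbc
      (hφL ξ _) hFs (hFv _ le_rfl))
    -- With N the squared norm of φ w on (a, d), the weights 4, 4(C + 1), 4 below make each of three
    -- integrals contribute at most N/8. What remains is 5N/8 ≤ 4‖F‖² + 2(C + 1)‖φ ξ‖², so this
    -- bound suffices; it is independent of d because F and ξ are. Using C + 1 instead of C keeps
    -- the weight positive.
    refine eq_zero_of_memL2A_fund hα h0 (memL2A_of_bounded (d₀ := a + 1)
      (C := 8 * (S.normSqA (Ioi a) F).toReal +
        4 * (C + 1) * (S.normSqA (Ioo a (a + 1)) (φ ξ)).toReal) ?_ (hφL w) fun d hd => ?_)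
    · refine ContinuousOn.aestronglyMeasurable (fun x hx => ?_) measurableSet_Ioi
      refine (((hφs w).continuousOn (q := x + 1) le_rfl).continuousAt ?_).continuousWithinAt
      exact Icc_mem_nhds hx (by linarith)
    have had : a ≤ d := by linarith
    obtain ⟨H, u, hHac, hHbc, hHL, hHs, -, hHv, hHK⟩ := hC d had (φ w) (hφL w _)
    have hN := hpair had (hHac _ had) hHbc
      (hφL w _) hHs (hHv _ le_rfl) w
    have hsub : ∀ q, Ioo a q ⊆ Ioi a := fun q => Ioo_subset_Ioi_self
    have hsub' : Ioo (a + 1) d ⊆ Ioi a := fun x hx => by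
      simp only [mem_Ioi]; linarith [hx.1]
    have e1 : jform (F d) (H d) = star v ⬝ᵥ (R *ᵥ u) := by
      rw [hFv d hd, hHv d le_rfl, hΨR v u d had]
    have e2 := jform_eq_add_integral_of_real le_rfl (by linarith : a ≤ a + 1)
      (hFac _ (by linarith)) (hHac _ (by linarith)) hFs (hHs.mono (Ioo_subset_Ioo_right hd))
      (hφL ξ _) (hφL w _)
    have hmono : ∀ {G : ℝ → CVec m}, (∀ D, a ≤ D → AbsolutelyContinuousOnInterval G a D) →
        AbsolutelyContinuousOnInterval G (a + 1) d := fun hG => (hG d had).mono (by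
      rw [uIcc_of_le hd, uIcc_of_le had]; exact Icc_subset_Icc_left (by linarith))
    have hsub2 : Ioo (a + 1) d ⊆ Ioo a d := Ioo_subset_Ioo_left (by linarith)
    have e3 := jform_eq_add_integral_of_real (f := 0) (by linarith : a ≤ a + 1) hd
      (hmono hFac) (hmono hHac) (by rw [add_zero]; exact hFs'.mono Ioo_subset_Ioi_self)
      (hHs.mono hsub2) (S.memL2A_zero _) ((hφL w d).mono hsub2)
    rw [hα.jform_eq_zero hFbc hHbc, zero_add] at e2
    have e4 : ∫ x in Ioo (a + 1) d, S.aform x ((0 : ℝ → CVec m) x) (H x) = 0 := by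
      simp [aform]
    have hle : ∀ {s t : Set ℝ} {G : ℝ → CVec m}, s ⊆ t → S.MemL2A t G →
        (S.normSqA s G).toReal ≤ (S.normSqA t G).toReal := fun hst hG =>
      ENNReal.toReal_mono hG.2.ne (lintegral_mono_set hst)
    have b1 := S.norm_integral_aform_le (hsub (a + 1)) (hFL.mono (hsub _)) (hφL w _)
      (t := 4) (by norm_num)
    have b2 := S.norm_integral_aform_le (hsub (a + 1)) (hφL ξ _) (hHL.mono (hsub _))
      (t := 4 * (C + 1)) (by positivity)
    have b3 := S.norm_integral_aform_le hsub' (hFL.mono hsub') ((hφL w d).mono hsub2)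
      (t := 4) (by norm_num)
    have c1 := hle (hsub (a + 1)) hFL
    have c2 := hle hsub' hFL
    have c3 := hle (Ioo_subset_Ioo_right hd) (hφL w d)
    have c4 := hle hsub2 (hφL w d)
    have c5 := hle (hsub (a + 1)) hHL
    have c6 : (S.normSqA (Ioi a) H).toReal ≤ C * (S.normSqA (Ioo a d) (φ w)).toReal := by
      have := ENNReal.toReal_mono (ENNReal.mul_ne_top ENNReal.coe_ne_top (hφL w d).2.ne) hHK
      rwa [ENNReal.toReal_mul, ENNReal.coe_toReal] at this
    have hNr := S.integral_aform_self (hsub d) (hφL w d)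
    rw [← hN, hwK, ← e1, e3, e2, e4, sub_zero, Complex.add_re, Complex.sub_re] at hNr
    have n1 := (Complex.re_le_norm _).trans b1
    have n2 := (neg_le_abs _).trans ((Complex.abs_re_le_norm _).trans b2)
    have n3 := (Complex.re_le_norm _).trans b3
    have hN0 : 0 ≤ (S.normSqA (Ioo a d) (φ w)).toReal := ENNReal.toReal_nonneg
    have c7 : (4 * ((C : ℝ) + 1))⁻¹ * (S.normSqA (Ioo a (a + 1)) H).toReal ≤
        (S.normSqA (Ioo a d) (φ w)).toReal / 4 := by
      rw [inv_mul_le_iff₀ (by positivity)]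
      have hC0 : (0 : ℝ) ≤ C := C.2
      nlinarith
    have hf0 : 0 ≤ (S.normSqA (Ioo a (a + 1)) (φ ξ)).toReal * (C + 1) := by positivity
    have hF0 : 0 ≤ (S.normSqA (Ioi a) F).toReal := ENNReal.toReal_nonneg
    linarith
  have : R = 0 := by
    have h1 : (R * K⁻¹)ᴴ = 0 := Matrix.ext_of_mulVec_single fun i => by
      rw [hR0, zero_mulVec]
    have h2 : R * K⁻¹ = 0 := by rwa [conjTranspose_eq_zero] at h1
    rw [← Matrix.nonsing_inv_mul_cancel_right K R ((Matrix.isUnit_iff_isUnit_det _).1 hKu), h2,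
      Matrix.zero_mul]
  refine Matrix.ext_of_mulVec_single fun i => ?_
  rw [zero_mulVec]
  funext j
  have h := hΨR (Pi.single j 1) (Pi.single i 1) x hx
  rw [jform_mulVec, this, zero_mulVec, dotProduct_zero, ← Pi.single_star, star_one,
    single_one_dotProduct] at h
  exact h

end HamiltonianSystem

/-! ### Prüfer angles of Lagrangian matrices -/

section Pruefer

variable {m : ℕ}

lemma fromRows_J_fromRows (P₁ P₂ : Matrix (Fin m) (Fin m) ℂ) :
    (fromRows P₁ P₂)ᴴ * Matrix.J (Fin m) ℂ * fromRows P₁ P₂ = P₂ᴴ * P₁ - P₁ᴴ * P₂ := by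
  rw [conjTranspose_fromRows_eq_fromCols_conjTranspose, J, fromCols_mul_fromBlocks,
    fromCols_mul_fromRows]
  simp [sub_eq_add_neg]

/-- If a polynomial matrix pencil is regular at some complex point, it is at some real point. -/
lemma exists_real_isUnit_add_smul {n : Type*} [Fintype n] [DecidableEq n] {M N : Matrix n n ℂ}
    {z : ℂ} (h : IsUnit (M + z • N)) : ∃ s : ℝ, IsUnit (M + (s : ℂ) • N) := by
  set p : Polynomial ℂ :=
    (M.map Polynomial.C + (Polynomial.X : Polynomial ℂ) • N.map Polynomial.C).det with hp
  have heval : ∀ w : ℂ, p.eval w = (M + w • N).det := by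
    intro w
    rw [hp, ← Polynomial.coe_evalRingHom, RingHom.map_det]
    congr 1
    ext i j
    simp
    exact mul_comm _ _
  have hp0 : p ≠ 0 := by
    rintro h0
    have := heval z
    rw [h0, Polynomial.eval_zero] at this
    exact ((Matrix.isUnit_iff_isUnit_det _).1 h).ne_zero this.symm
  by_contra hcon
  push Not at hcon
  refine hp0 (Polynomial.eq_zero_of_infinite_isRoot p ?_)
  refine (Set.infinite_range_of_injective Complex.ofReal_injective).mono ?_
  rintro _ ⟨s, rfl⟩
  change p.eval _ = 0
  rw [heval]
  by_contra h1
  exact hcon s ((Matrix.isUnit_iff_isUnit_det _).2 (isUnit_iff_ne_zero.2 h1))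

/-- A Lagrangian `2m × m` matrix has a Prüfer angle. -/
theorem exists_isPrueferAngle {P : Matrix (Fin m ⊕ Fin m) (Fin m) ℂ}
    (hP : ∀ v, P *ᵥ v = 0 → v = 0) (hJ : Pᴴ * Matrix.J (Fin m) ℂ * P = 0) :
    ∃ θ, IsPrueferAngle P θ := by
  obtain ⟨P₁, P₂, rfl⟩ : ∃ P₁ P₂, P = fromRows P₁ P₂ := ⟨_, _, (fromRows_toRows P).symm⟩
  rw [fromRows_J_fromRows, sub_eq_zero] at hJ
  -- Isotropy cancels the cross terms: |(P₂ + iP₁)v|² = |P₁v|² + |P₂v|².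
  have hu : IsUnit (P₂ + Complex.I • P₁) := by
    refine isUnit_of_mulVec_eq_zero fun v hv => hP v ?_
    have h1 : star ((P₂ + Complex.I • P₁) *ᵥ v) ⬝ᵥ ((P₂ + Complex.I • P₁) *ᵥ v) =
        star (P₁ *ᵥ v) ⬝ᵥ (P₁ *ᵥ v) + star (P₂ *ᵥ v) ⬝ᵥ (P₂ *ᵥ v) := by
      simp only [star_mulVec_dotProduct, mulVec_mulVec, ← dotProduct_add, ← add_mulVec]
      congr 2
      rw [conjTranspose_add, conjTranspose_smul, Complex.star_def, Complex.conj_I, Matrix.add_mul,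
        Matrix.mul_add, Matrix.mul_add, Matrix.mul_smul, Matrix.smul_mul, Matrix.smul_mul,
        Matrix.mul_smul, smul_smul, hJ]
      simp only [neg_mul, Complex.I_mul_I, neg_neg, one_smul, neg_smul]
      abel
    rw [hv, star_zero, zero_dotProduct] at h1
    have n1 : 0 ≤ star (P₁ *ᵥ v) ⬝ᵥ (P₁ *ᵥ v) := dotProduct_star_self_nonneg _
    have n2 : 0 ≤ star (P₂ *ᵥ v) ⬝ᵥ (P₂ *ᵥ v) := dotProduct_star_self_nonneg _
    obtain ⟨e1, e2⟩ := (add_eq_zero_iff_of_nonneg n1 n2).1 h1.symm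
    rw [dotProduct_star_self_eq_zero] at e1 e2
    rw [fromRows_mulVec, e1, e2]
    funext i
    rcases i with i | i <;> rfl
  -- P₂ may be singular, so tan θ = P₁P₂⁻¹ is not available. Rotating by the angle arctan s makes
  -- the lower block Y invertible (up to the factor √(1 + s²)), and H = XY⁻¹ is the Hermitian
  -- tangent after rotation.
  obtain ⟨s, hs⟩ := exists_real_isUnit_add_smul hu
  set Y := P₂ + (s : ℂ) • P₁ with hY
  set X := P₁ - (s : ℂ) • P₂ with hX
  have hYd := (Matrix.isUnit_iff_isUnit_det _).1 hs
  set H := X * Y⁻¹ with hH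
  have hHY : H * Y = X := by rw [hH, Matrix.nonsing_inv_mul_cancel_right _ _ hYd]
  have hXY : Yᴴ * X = Xᴴ * Y := by
    simp only [hX, hY, conjTranspose_add, conjTranspose_sub, conjTranspose_smul, Complex.star_def,
      Complex.conj_ofReal, Matrix.add_mul, Matrix.sub_mul, Matrix.mul_add, Matrix.mul_sub,
      Matrix.mul_smul, Matrix.smul_mul, hJ]
    module
  have hHh : IsSelfAdjoint H := by
    change Hᴴ = H
    have h1 : Yᴴ * Hᴴ * Y = Yᴴ * H * Y := by
      rw [← conjTranspose_mul, hHY, ← hXY, Matrix.mul_assoc, hHY]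
    have h2 : IsUnit Yᴴ := hs.star
    rw [hs.mul_left_inj, h2.mul_right_inj] at h1
    exact h1
  have hs0 : (0 : ℝ) < 1 + s ^ 2 := by positivity
  set q := √(1 + s ^ 2) with hq
  have hq0 : 0 < q := Real.sqrt_pos.2 hs0
  have hqq : q * q = 1 + s ^ 2 := Real.mul_self_sqrt hs0.le
  -- Adding arctan s undoes the rotation. The factor √(1 + H²)/q in ρ cancels the denominators in
  -- the addition formulas, leaving (1 + s²)P₁ = X + sY and (1 + s²)P₂ = Y - sX.
  set θ : Matrix (Fin m) (Fin m) ℂ := cfc (fun h : ℝ => Real.arctan h + Real.arctan s) H with hθ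
  set ρ : Matrix (Fin m) (Fin m) ℂ := cfc (fun h : ℝ => √(1 + h ^ 2) / q) H * Y with hρ
  have hsin : cfc Real.sin θ * ρ = P₁ := by
    rw [hθ, ← cfc_comp' Real.sin (fun h : ℝ => Real.arctan h + Real.arctan s) H, hρ,
      ← Matrix.mul_assoc, ← cfc_mul _ _ H]
    have e : (fun h : ℝ => Real.sin (Real.arctan h + Real.arctan s) * (√(1 + h ^ 2) / q)) =
        fun h => (q * q)⁻¹ * (h + s) := by
      funext h
      have h1 : 0 < √(1 + h ^ 2) := Real.sqrt_pos.2 (by positivity)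
      rw [Real.sin_add, Real.sin_arctan, Real.cos_arctan, Real.sin_arctan, Real.cos_arctan, ← hq]
      field_simp
    rw [e, cfc_const_mul _ _ H, cfc_add_const s _ H, cfc_id' ℝ H, hqq, smul_mul_assoc, Matrix.add_mul, hHY,
      ← Algebra.smul_def, inv_smul_eq_iff₀ hs0.ne', hX, hY]
    ext i j
    simp
    ring
  have hcos : cfc Real.cos θ * ρ = P₂ := by
    rw [hθ, ← cfc_comp' Real.cos (fun h : ℝ => Real.arctan h + Real.arctan s) H, hρ,
      ← Matrix.mul_assoc, ← cfc_mul _ _ H]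
    have e : (fun h : ℝ => Real.cos (Real.arctan h + Real.arctan s) * (√(1 + h ^ 2) / q)) =
        fun h => (q * q)⁻¹ * (-s * h + 1) := by
      funext h
      have h1 : 0 < √(1 + h ^ 2) := Real.sqrt_pos.2 (by positivity)
      rw [Real.cos_add, Real.sin_arctan, Real.cos_arctan, Real.sin_arctan, Real.cos_arctan, ← hq]
      field_simp
      ring
    rw [e, cfc_const_mul _ _ H, cfc_add_const 1 _ H, cfc_const_mul _ _ H, cfc_id' ℝ H, hqq,
      smul_mul_assoc, Matrix.add_mul, smul_mul_assoc, hHY, ← Algebra.smul_def,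
      inv_smul_eq_iff₀ hs0.ne', hX, hY]
    ext i j
    simp
    ring
  have hPρ : fromRows P₁ P₂ = sinCos θ * ρ := by
    rw [sinCos, fromRows_mul, hsin, hcos]
  refine ⟨θ, ?_, ρ, ?_, hPρ⟩
  · exact cfc_predicate (p := IsSelfAdjoint) _ H
  · refine Matrix.PosDef.conjTranspose_mul_self _ fun u v huv => ?_
    rw [← sub_eq_zero]
    refine hP _ ?_
    rw [hPρ, ← mulVec_mulVec, mulVec_sub]
    rw [show ρ *ᵥ u = ρ *ᵥ v from huv, sub_self, mulVec_zero]

end Pruefer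

/-! ### The finite interval: spectrum and eigenvalue counts -/

/-- The eigenvalue problem for a pencil and for its sandwiched resolvent. -/
lemma nullity_sub_eq {M N X : Type} [AddCommGroup M] [Module ℂ M] [AddCommGroup N] [Module ℂ N]
    [AddCommGroup X] [Module ℂ X] (T : M ≃ₗ[ℂ] N) (E : X →ₗ[ℂ] N) (h : M →ₗ[ℂ] X) {d : ℂ}
    (hd : d ≠ 0) :
    nullity (T.toLinearMap - d • E.comp h) =
      nullity (h.comp (T.symm.toLinearMap.comp E) - d⁻¹ • LinearMap.id) := by
  have h1 : ∀ x : M, (T.toLinearMap - d • E.comp h) x = 0 ↔ x = d • T.symm (E (h x)) := by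
    intro x
    rw [← map_smul, LinearEquiv.eq_symm_apply]
    simp [sub_eq_zero]
  have h2 : ∀ y : X, (h.comp (T.symm.toLinearMap.comp E) - d⁻¹ • (LinearMap.id : X →ₗ[ℂ] X)) y = 0 ↔
      d • h (T.symm (E y)) = y := by
    intro y
    rw [← eq_inv_smul_iff₀ hd]
    simp [sub_eq_zero]
  -- A kernel element satisfies x = d T⁻¹E(hx), so it is recovered from hx; the inverse map is y ↦ d
  -- T⁻¹Ey.
  refine LinearEquiv.rank_eq (LinearEquiv.ofBijective (h.restrict fun x hx => ?_) ⟨?_, ?_⟩)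
  · rw [LinearMap.mem_ker, h1] at hx
    rw [LinearMap.mem_ker, h2, ← map_smul, ← hx]
  · rintro ⟨x, hx⟩ ⟨y, hy⟩ hxy
    have e : h x = h y := congrArg Subtype.val hxy
    rw [LinearMap.mem_ker, h1] at hx hy
    rw [Subtype.mk.injEq, hx, hy, e]
  · rintro ⟨y, hy⟩
    rw [LinearMap.mem_ker, h2] at hy
    have e : h (d • T.symm (E y)) = y := by rw [map_smul, hy]
    refine ⟨⟨d • T.symm (E y), ?_⟩, Subtype.ext e⟩
    rw [LinearMap.mem_ker, h1, e]

/-- The columns of P and JP form a basis. Applying P*J to u = Pv + JPw annihilates Pv by isotropy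
and leaves -P*Pw, so w = 0. -/
lemma exists_eq_mulVec_of_lagrangian {m : ℕ} {P : Matrix (Fin m ⊕ Fin m) (Fin m) ℂ}
    (hP : ∀ v, P *ᵥ v = 0 → v = 0) (hJ : Pᴴ * Matrix.J (Fin m) ℂ * P = 0) {u : CVec m}
    (hu : Pᴴ *ᵥ (Matrix.J (Fin m) ℂ *ᵥ u) = 0) : ∃ v, u = P *ᵥ v := by
  have key : ∀ v w : Fin m → ℂ,
      Pᴴ *ᵥ (Matrix.J (Fin m) ℂ *ᵥ (P *ᵥ v + Matrix.J (Fin m) ℂ *ᵥ (P *ᵥ w))) = 0 → w = 0 := by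
    intro v w h
    have e : Pᴴ *ᵥ (Matrix.J (Fin m) ℂ *ᵥ (P *ᵥ v)) = 0 := by
      rw [mulVec_mulVec, mulVec_mulVec, hJ, zero_mulVec]
    rw [mulVec_add, J_mulVec_J, mulVec_add, e, zero_add, mulVec_neg, neg_eq_zero] at h
    refine hP w (dotProduct_star_self_eq_zero.1 ?_)
    rw [star_mulVec_dotProduct, h, dotProduct_zero]
  have hQ : IsUnit (fromCols P (Matrix.J (Fin m) ℂ * P)) := by
    refine isUnit_of_mulVec_eq_zero fun v hv => ?_
    rw [fromCols_mulVec, ← mulVec_mulVec] at hv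
    have hw := key (v ∘ Sum.inl) (v ∘ Sum.inr) (by rw [hv, mulVec_zero, mulVec_zero])
    rw [hw, mulVec_zero, mulVec_zero, add_zero] at hv
    have hv' := hP _ hv
    funext i
    rcases i with i | i
    · exact congrFun hv' i
    · exact congrFun hw i
  obtain ⟨v, hv⟩ := (Matrix.mulVec_surjective_iff_isUnit.2 hQ) u
  rw [fromCols_mulVec, ← mulVec_mulVec] at hv
  have hw := key (v ∘ Sum.inl) (v ∘ Sum.inr) (by rw [hv, hu])
  rw [hw, mulVec_zero, mulVec_zero, add_zero] at hv
  exact ⟨_, hv.symm⟩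

/-- The factor ρ is invertible, so the boundary condition at c depends only on the values of the
solution and not on the choice of θ. -/
lemma IsPrueferAngle.mulVec_eq_zero_iff {m : ℕ} {P : Matrix (Fin m ⊕ Fin m) (Fin m) ℂ}
    {θ : Matrix (Fin m) (Fin m) ℂ} (h : IsPrueferAngle P θ) (u : CVec m) :
    (sinCos θ)ᴴ *ᵥ u = 0 ↔ Pᴴ *ᵥ u = 0 := by
  obtain ⟨-, ρ, hρ, rfl⟩ := h
  have h1 : IsUnit ρᴴ := isUnit_of_mul_isUnit_left hρ.isUnit
  rw [conjTranspose_mul, ← mulVec_mulVec]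
  refine ⟨fun h => by rw [h, mulVec_zero], fun h => ?_⟩
  refine Matrix.mulVec_injective_iff_isUnit.2 h1 ?_
  rw [h, mulVec_zero]

namespace HamiltonianSystem

variable {m r : ℕ} {a : ℝ} {S : HamiltonianSystem m r a}
  {α γ : Matrix (Fin m ⊕ Fin m) (Fin m) ℂ} {l x₀ c : ℝ}
  {Ψ : ℝ → Matrix (Fin m ⊕ Fin m) (Fin m) ℂ}

/-- Elements of the domain of `T_{a,c}` from solutions of inhomogeneous equations. -/
lemma exists_domFin (hc : a < c) {G k : ℝ → CVec m} (hG : AbsolutelyContinuousOnInterval G a c)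
    (hk : S.MemL2A (Ioo a c) k) (hs : S.SolvesOn (Ioo a c) G k)
    (hα : αᴴ *ᵥ (Matrix.J (Fin m) ℂ *ᵥ G a) = 0) (hγ : γᴴ *ᵥ (Matrix.J (Fin m) ℂ *ᵥ G c) = 0) :
    ∃ F : S.domFin α γ c, ∀ x ∈ Icc a c, ((F : S.maxDom c) : ℝ → CVec m) x = G x := by
  have hEq : ∀ x ∈ Icc a c, (Icc a c).indicator G x = G x := fun x hx => indicator_of_mem hx G
  have hcont : ContinuousOn G (Icc a c) := by
    have := hG.continuousOn
    rwa [uIcc_of_le hc.le] at this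
  have hmem : (Icc a c).indicator G ∈ S.maxDom c := by
    refine S.mem_maxDom (k := k) (fun x hx => ?_) (fun d h1 h2 => ?_) ?_ ?_ ?_
    · exact indicator_of_notMem (fun h => hx ⟨h.1, EReal.coe_le_coe_iff.2 h.2⟩) G
    · have h2' : d ≤ c := EReal.coe_le_coe_iff.1 h2
      refine (hG.mono ?_).congr fun x hx => (hEq x ?_).symm
      · rw [uIcc_of_le h1, uIcc_of_le hc.le]
        exact Icc_subset_Icc_right h2'
      · rw [uIcc_of_le h1] at hx
        exact ⟨hx.1, hx.2.trans h2'⟩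
    · rw [ival_coe]
      exact S.memL2A_of_continuousOn le_rfl (hcont.congr hEq)
    · rwa [ival_coe]
    · rw [ival_coe]
      exact hs.congr measurableSet_Ioo isOpen_Ioo
        (fun x hx => (hEq x (Ioo_subset_Icc_self hx)).symm) (.of_forall fun _ => rfl)
  refine ⟨⟨⟨_, hmem⟩, ?_, ?_⟩, hEq⟩
  · change αᴴ *ᵥ (Matrix.J (Fin m) ℂ *ᵥ (Icc a c).indicator G a) = 0
    rwa [hEq a ⟨le_rfl, hc.le⟩]
  · change γᴴ *ᵥ (Matrix.J (Fin m) ℂ *ᵥ (Icc a c).indicator G c) = 0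
    rwa [hEq c ⟨hc.le, le_rfl⟩]

lemma maxDom_ext {F G : S.maxDom (c : EReal)}
    (h : ∀ x ∈ Icc a c, (F : ℝ → CVec m) x = (G : ℝ → CVec m) x) : F = G := by
  refine Subtype.ext (funext fun x => ?_)
  by_cases hx : x ∈ Icc a c
  · exact h x hx
  · have hx' : ¬(a ≤ x ∧ (x : EReal) ≤ c) := fun h => hx ⟨h.1, EReal.coe_le_coe_iff.1 h.2⟩
    rw [F.2.1 x hx', G.2.1 x hx']

lemma solvesOn_ival_coe {F k : ℝ → CVec m} :
    S.SolvesOn (ival a (c : EReal)) F k ↔ S.SolvesOn (Ioo a c) F k := by rw [ival_coe]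

lemma memL2A_ival_coe {F : ℝ → CVec m} :
    S.MemL2A (ival a (c : EReal)) F ↔ S.MemL2A (Ioo a c) F := by rw [ival_coe]

lemma normSqA_ival_coe (F : ℝ → CVec m) :
    S.normSqA (ival a (c : EReal)) F = S.normSqA (Ioo a c) F := by rw [ival_coe]

lemma pencil_coe_eq_iff {D : Submodule ℂ (S.maxDom (c : EReal))} {z : ℂ} (F : D)
    (g : S.ErL2A (c : EReal)) :
    S.pencil D z F = g ↔
      S.SolvesOn (Ioo a c) (F : S.maxDom c) (z • ((F : S.maxDom c) : ℝ → CVec m) + g.1) := by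
  rw [S.pencil_eq_iff, solvesOn_ival_coe]

lemma pencil_coe_eq_zero_iff {D : Submodule ℂ (S.maxDom (c : EReal))} {z : ℂ} (F : D) :
    S.pencil D z F = 0 ↔
      S.SolvesOn (Ioo a c) (F : S.maxDom c) (z • ((F : S.maxDom c) : ℝ → CVec m)) := by
  rw [pencil_coe_eq_iff]
  have h : ∀ᵐ x ∂volume.restrict (Ioo a c),
      (((0 : S.ErL2A (c : EReal)).1) : ℝ → CVec m) x = 0 := by
    rw [← ival_coe]
    exact AEEqFun.coeFn_zero (μ := volume.restrict (ival a c)) (β := CVec m)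
  constructor <;> intro hs
  · refine hs.congr measurableSet_Ioo isOpen_Ioo (fun _ _ => rfl) (h.mono fun x hx => ?_)
    rw [Pi.add_apply, hx, add_zero]
  · refine hs.congr measurableSet_Ioo isOpen_Ioo (fun _ _ => rfl) (h.mono fun x hx => ?_)
    rw [Pi.add_apply, hx, add_zero]

lemma maxDom_ac (hc : a ≤ c) (F : S.maxDom (c : EReal)) :
    AbsolutelyContinuousOnInterval (F : ℝ → CVec m) a c := F.2.2.1 c hc le_rfl

/-- If `F(c)` ranges over the values of the Weyl–Titchmarsh solution, then the resolvent set of the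
half-line operator is inherited by the finite interval. -/
theorem IsWeylPlus.notMem_spectrum_domFin (hΨ : S.IsWeylPlus l x₀ Ψ) (hα : IsBoundaryMatrix α)
    (hx₀ : a ≤ x₀) (h0 : (l : ℂ) ∉ S.spectrum (S.domHalf α)) (hc : a < c)
    (hγ : ∀ u : CVec m, γᴴ *ᵥ (Matrix.J (Fin m) ℂ *ᵥ u) = 0 ↔ ∃ v, u = Ψ c *ᵥ v) :
    (l : ℂ) ∉ S.spectrum (S.domFin α γ c) := by
  have hinj : Function.Injective (S.pencil (S.domFin α γ c) (l : ℂ)) := by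
    rw [← LinearMap.ker_eq_bot, LinearMap.ker_eq_bot']
    intro F hF
    rw [pencil_coe_eq_zero_iff] at hF
    -- The condition at c makes F continue as Ψv, a square-integrable half-line solution that
    -- satisfies the condition at a and therefore vanishes.
    obtain ⟨v, hv⟩ := (hγ _).1 F.2.2
    have hFΨ : ∀ x ∈ Icc a c, ((F : S.maxDom c) : ℝ → CVec m) x = Ψ x *ᵥ v := fun x hx =>
      S.eq_of_solvesOn le_rfl (maxDom_ac hc.le _) hF ((hΨ.1.mulVec v).ac le_rfl hc.le)
        ((hΨ.1.mulVec v).solvesOn.mono Ioo_subset_Ioi_self) ⟨hc.le, le_rfl⟩ hv hx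
    have hbc : αᴴ *ᵥ (Matrix.J (Fin m) ℂ *ᵥ (Ψ a *ᵥ v)) = 0 := by
      rw [← hFΨ a ⟨le_rfl, hc.le⟩]
      exact F.2.1
    refine Subtype.ext (maxDom_ext fun x hx => ?_)
    rw [hFΨ x hx]
    exact S.eq_zero_of_isSolution_half h0 (hΨ.1.mulVec v) hbc (hΨ.memL2A v) hx.1
  obtain ⟨K, hK⟩ := hΨ.exists_solvesOn_compact hα hx₀ h0
  have hsurj : ∀ g : S.ErL2A (c : EReal), ∃ F : S.domFin α γ c,
      S.pencil (S.domFin α γ c) l F = g ∧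
      S.normSqA (ival a c) (F : S.maxDom c) ≤ K * S.normSqA (ival a c) g.1 := by
    intro g
    have hg := memL2A_ival_coe.1 (S.ErL2A_memL2A g)
    rw [normSqA_ival_coe]
    -- The half-line solution equals Ψv at c, so its restriction satisfies the right boundary
    -- condition and inherits the resolvent bound.
    obtain ⟨G, v, hac, hbc, hL, hs, -, hv, hle⟩ := hK c hc.le g.1 hg
    obtain ⟨F, hF⟩ := S.exists_domFin (γ := γ) hc (hac c hc.le)
      (((hL.mono Ioo_subset_Ioi_self).smul _).add Ioo_subset_Ioi_self hg) hs hbc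
      ((hγ _).2 ⟨v, hv c le_rfl⟩)
    have hEq : ∀ x ∈ Ioo a c, G x = ((F : S.maxDom c) : ℝ → CVec m) x := fun x hx =>
      (hF x (Ioo_subset_Icc_self hx)).symm
    refine ⟨F, (pencil_coe_eq_iff F g).2 (hs.congr measurableSet_Ioo isOpen_Ioo hEq ?_), ?_⟩
    · filter_upwards [ae_restrict_mem measurableSet_Ioo] with x hx
      rw [Pi.add_apply, Pi.add_apply, Pi.smul_apply, Pi.smul_apply, hEq x hx]
    · rw [normSqA_ival_coe, ← S.normSqA_congr_set measurableSet_Ioo hEq]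
      exact (lintegral_mono_set Ioo_subset_Ioi_self).trans hle
  refine not_not.2 ⟨⟨hinj, fun g => ?_⟩, K, fun F => ?_⟩
  · obtain ⟨F, hF, -⟩ := hsurj g
    exact ⟨F, hF⟩
  · obtain ⟨G, hG, hle⟩ := hsurj (S.pencil (S.domFin α γ c) l F)
    rwa [hinj hG] at hle

/-- The eigenvalue problem on `(a, c)` in terms of the resolvent. -/
theorem nullity_pencil_eq_restrictedResolvent {D : Submodule ℂ (S.maxDom (c : EReal))} {z w : ℂ}
    (h : z ∉ S.spectrum D) (hzw : w ≠ z) :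
    nullity (S.pencil D w) =
      nullity (S.restrictedResolvent h - (w - z)⁻¹ • LinearMap.id) := by
  have e : S.pencil D w =
      (LinearEquiv.ofBijective (S.pencil D z) (S.bijective_of_notMem_spectrum h)).toLinearMap -
        (w - z) • (S.extE c).comp ((S.hatOp c).comp D.subtype) := by
    refine LinearMap.ext fun F => ?_
    change S.maxOp c F - w • S.ErOp c F = (S.maxOp c F - z • S.ErOp c F) - (w - z) • S.ErOp c F
    module
  rw [e]
  exact nullity_sub_eq _ _ _ (sub_ne_zero.2 hzw)

/-- The eigenfunctions on `(a, c)` are combinations of the columns of the solution that satisfies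
the boundary condition at `a`. -/
theorem IsWeylMinus.nullity_pencil_eq (hΨ : S.IsWeylMinus α l x₀ Ψ) (hα : IsBoundaryMatrix α)
    (hx₀ : a ≤ x₀) (hc : a < c) {M : Matrix (Fin m) (Fin m) ℂ}
    (hM : ∀ v, M *ᵥ v = 0 ↔ γᴴ *ᵥ (Matrix.J (Fin m) ℂ *ᵥ (Ψ c *ᵥ v)) = 0) :
    nullity (S.pencil (S.domFin α γ c) l) = nullity M.mulVecLin := by
  have hbc : ∀ v, αᴴ *ᵥ (Matrix.J (Fin m) ℂ *ᵥ (Ψ a *ᵥ v)) = 0 := fun v => by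
    rw [mulVec_mulVec, mulVec_mulVec, hΨ.2.1, zero_mulVec]
  have hsol := fun v => hΨ.1.mulVec v
  set β := αᴴ * Ψ a with hβ
  have hαβ : ∀ v, Ψ a *ᵥ v = α *ᵥ (β *ᵥ v) := fun v => by
    rw [hβ, ← mulVec_mulVec]
    exact hα.eq_mulVec (hbc v)
  have hβu : IsUnit β := isUnit_of_mulVec_eq_zero fun v hv =>
    hΨ.1.mulVec_eq_zero hΨ.2.2 hx₀ le_rfl (by rw [hαβ, hv, mulVec_zero])
  have hβd := (Matrix.isUnit_iff_isUnit_det _).1 hβu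
  -- Since F(a) ∈ ran α and Ψ(a) = αβ with β invertible, the coefficient vector v in F = Ψv is
  -- β⁻¹α*F(a).
  obtain ⟨L, hLdef⟩ : ∃ L : LinearMap.ker (S.pencil (S.domFin α γ c) l) →ₗ[ℂ] (Fin m → ℂ),
      ∀ F, L F = β⁻¹ *ᵥ (αᴴ *ᵥ ((F : S.domFin α γ c) : S.maxDom c).1 a) :=
    ⟨β⁻¹.mulVecLin.comp (αᴴ.mulVecLin.comp ((LinearMap.proj a).comp ((Submodule.subtype _).comp
      ((Submodule.subtype _).comp (Submodule.subtype _))))), fun _ => rfl⟩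
  have hL : ∀ F : LinearMap.ker (S.pencil (S.domFin α γ c) l), ∀ x ∈ Icc a c,
      ((F : S.domFin α γ c) : S.maxDom c).1 x = Ψ x *ᵥ L F := by
    intro F x hx
    have hF := (pencil_coe_eq_zero_iff _).1 F.2
    refine S.eq_of_solvesOn le_rfl (maxDom_ac hc.le _) hF ((hsol _).ac le_rfl hc.le)
      ((hsol _).solvesOn.mono Ioo_subset_Ioi_self) ⟨le_rfl, hc.le⟩ ?_ hx
    rw [hαβ, hLdef, mulVec_mulVec _ β, Matrix.mul_nonsing_inv _ hβd, one_mulVec]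
    exact hα.eq_mulVec F.1.2.1
  refine LinearEquiv.rank_eq (LinearEquiv.ofBijective
    (L.codRestrict (LinearMap.ker M.mulVecLin) fun F => ?_) ⟨?_, ?_⟩)
  · rw [LinearMap.mem_ker, mulVecLin_apply, hM, ← hL F c ⟨hc.le, le_rfl⟩]
    exact F.1.2.2
  · intro F G hFG
    have e : L F = L G := congrArg Subtype.val hFG
    refine Subtype.ext (Subtype.ext (maxDom_ext fun x hx => ?_))
    exact (hL F x hx).trans (by rw [e]; exact (hL G x hx).symm)
  · rintro ⟨v, hv⟩
    rw [LinearMap.mem_ker, mulVecLin_apply, hM] at hv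
    obtain ⟨F, hF⟩ := S.exists_domFin (α := α) (γ := γ) hc ((hsol v).ac le_rfl hc.le)
      (((hsol v).memL2A c).smul l) ((hsol v).solvesOn.mono Ioo_subset_Ioi_self) (hbc v) hv
    have hker : S.pencil (S.domFin α γ c) l F = 0 := by
      rw [pencil_coe_eq_zero_iff]
      refine ((hsol v).solvesOn.mono Ioo_subset_Ioi_self).congr measurableSet_Ioo isOpen_Ioo
        (fun x hx => (hF x (Ioo_subset_Icc_self hx)).symm) ?_
      filter_upwards [ae_restrict_mem measurableSet_Ioo] with x hx
      rw [Pi.smul_apply, Pi.smul_apply, hF x (Ioo_subset_Icc_self hx)]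
    refine ⟨⟨F, hker⟩, Subtype.ext ?_⟩
    change L ⟨F, hker⟩ = v
    rw [hLdef, hF a ⟨le_rfl, hc.le⟩, mulVec_mulVec _ αᴴ, ← hβ, mulVec_mulVec,
      Matrix.nonsing_inv_mul _ hβd, one_mulVec]

end HamiltonianSystem

end

theorem theorem3p4 {m r : ℕ} {a : ℝ} (S : HamiltonianSystem m r a)
    (hdef : S.Definite) (hlp : S.LimitPoint)
    (α : Matrix (Fin m ⊕ Fin m) (Fin m) ℂ) (hα : IsBoundaryMatrix α)
    (x₀ l0 l1 : ℝ) (hx₀ : a < x₀) (hl : l0 < l1)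
    (Ψp Ψm : ℝ → Matrix (Fin m ⊕ Fin m) (Fin m) ℂ)
    (hΨp : S.IsWeylPlus (l0 : ℂ) x₀ Ψp) (hΨm : S.IsWeylMinus α (l1 : ℂ) x₀ Ψm)
    (h0 : (l0 : ℂ) ∉ S.spectrum (S.domHalf α))
    (c : ℝ) (hc : a < c) :
    (∃ θ, IsPrueferAngle (Ψp c) θ) ∧
    ∀ θ, IsPrueferAngle (Ψp c) θ →
      ∃ h : (l0 : ℂ) ∉ S.spectrum (S.domFin α (sinCos θ) c),
        nullity (S.pencil (S.domFin α (sinCos θ) c) (l1 : ℂ)) =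
          nullity (S.restrictedResolvent h - ((l1 : ℂ) - (l0 : ℂ))⁻¹ • LinearMap.id) ∧
        nullity (S.restrictedResolvent h - ((l1 : ℂ) - (l0 : ℂ))⁻¹ • LinearMap.id) =
          nullity ((Ψp c)ᴴ * Matrix.J (Fin m) ℂ * Ψm c).mulVecLin := by
  have hP : ∀ v, Ψp c *ᵥ v = 0 → v = 0 := fun v =>
    hΨp.1.mulVec_eq_zero hΨp.2.2 hx₀.le hc.le
  have hJ : (Ψp c)ᴴ * Matrix.J (Fin m) ℂ * Ψp c = 0 :=
    hΨp.jform_eq_zero hdef hα hx₀.le h0 hc.le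
  refine ⟨exists_isPrueferAngle hP hJ, fun θ hθ => ?_⟩
  have h : (l0 : ℂ) ∉ S.spectrum (S.domFin α (sinCos θ) c) := by
    refine hΨp.notMem_spectrum_domFin hα hx₀.le h0 hc fun u => ?_
    rw [hθ.mulVec_eq_zero_iff]
    refine ⟨exists_eq_mulVec_of_lagrangian hP hJ, ?_⟩
    rintro ⟨v, rfl⟩
    rw [mulVec_mulVec, mulVec_mulVec, hJ, zero_mulVec]
  have h1 := HamiltonianSystem.nullity_pencil_eq_restrictedResolvent h (w := (l1 : ℂ))
    (by exact_mod_cast hl.ne')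
  refine ⟨h, h1, h1.symm.trans (hΨm.nullity_pencil_eq hα hx₀.le hc fun v => ?_)⟩
  rw [hθ.mulVec_eq_zero_iff, mulVec_mulVec, mulVec_mulVec]
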